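/- Let $M$ be a closed (compact, boundaryless, smooth) manifold with a Riemannian metric, with norms $\|\cdot\|_x$ on $T_xM$. A Lagrangian $L:TM\to\mathbb R$ is \emph{Tonelli} if $L\in C^2(TM)$, $\partial^2L/\partial v^2(x,v)$ is positive definite for all $(x,v)$, and $L(x,v)/\|v\|_x\to+\infty$ as $\|v\|_x\to\infty$, uniformly in $x$. Let $\mathcal M(TM)$ be the set of Borel probability measures $\mu$ on $TM$ with $\int\|v\|_x\,d\mu<\infty$ that are closed, i.e. $\int_{TM} df_x(v)\,d\mu=0$ for all $f\in C^1(M)$. The rotation vector $\rho(\mu)\in H_1(M;\mathbb R)$ is determined by $\langle[\eta],\rho(\mu)\rangle=\int_{TM}\eta_x(v)\,d\mu$ for every closed 1-form $\eta$. For a Tonelli Lagrangian $L$ and $h\in H_1(M;\mathbb R)$ put $$\beta_L(h)=\min_{\mu\in\rho^{-1}(h)}\int_{TM}L\,d\mu .$$ Let $\mathfrak M_L^h$ be the set of measures in $\rho^{-1}(h)$ realizing this minimum (the Mather measures), and let $\widetilde{\mathcal M}_L^h\subset TM$ be the closure of the union of their supports (the Mather set of homology $h$). \textbf{Theorem.}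 Let $L:TM\to\mathbb R$ be a Tonelli Lagrangian, let $V\in C^2(M)$ with $\max_MV=0$, and let $L_V(x,v)=L(x,v)+V(x)$. Then the minima defining $\beta_L$ and $\beta_{L_V}$ are attained for every $h$, and: (i) $\beta_{L_V}(h)\le\beta_L(h)$ for every $h\in H_1(M;\mathbb R)$. (ii) For every $h\in H_1(M;\mathbb R)\setminus\{0\}$: $\beta_{L_V}(h)=\beta_L(h)$ if and only if $\mathfrak M_L^h\subseteq\mathfrak M_{L_V}^h$, $V\equiv0$ on $\widetilde{\mathcal M}_L^h$ (that is, $V(x)=0$ for all $(x,v)\in\widetilde{\mathcal M}_L^h$), and $\widetilde{\mathcal M}_L^h\subseteq\widetilde{\mathcal M}_{L_V}^h$. (iii) Suppose $M=\mathbb T^n=\mathbb R^n/\mathbb Z^n$ and $L(x,v)=\ell(v)$ in the canonical identification $T\mathbb T^n=\mathbb T^n\times\mathbb R^n$. Then for every $h\in H_1(\mathbb T^n;\mathbb R)\setminus\{0\}$: $\beta_{\ell+V}(h)=\beta_\ell(h)$ if and only if $V\equiv0$ on $\mathbb T^n$. -/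

import Mathlib

open Set Filter Topology MeasureTheory Bundle
open scoped Manifold ContDiff

universe u v

noncomputable section

namespace Mane

/-! ### First real homology and integration of closed 1-forms over singular chains -/

section Homology

open CategoryTheory CategoryTheory.Limits AlgebraicTopology Opposite
open scoped Simplicial

variable (X : Type v) [TopologicalSpace X]

/-- The singular chain complex `C_•(X; ℝ)`. -/
abbrev singularChains : ChainComplex (ModuleCat.{v} ℝ) ℕ :=
  ((singularChainComplexFunctor (ModuleCat.{v} ℝ)).obj (ModuleCat.of ℝ (ULift.{v} ℝ))).obj
    (TopCat.of X)

/-- The first real singular homology group `H₁(X; ℝ)`. -/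
abbrev H1 : ModuleCat.{v} ℝ :=
  ((singularHomologyFunctor (ModuleCat.{v} ℝ) 1).obj (ModuleCat.of ℝ (ULift.{v} ℝ))).obj
    (TopCat.of X)

variable {X}

/-- A singular 1-simplex: a continuous map from the standard 1-simplex. -/
abbrev Simplex1 (X : Type v) [TopologicalSpace X] : Type v := C(stdSimplex ℝ (Fin 2), X)

/-- The inclusion `ℝ → C₁(X; ℝ)` of the summand indexed by the singular simplex `σ`. -/
def elementaryChainHom (σ : Simplex1 X) :
    ModuleCat.of ℝ (ULift.{v} ℝ) ⟶ (singularChains X).X 1 :=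
  Sigma.ι (fun _ : (TopCat.toSSet.obj (TopCat.of X)).obj (op ⦋1⦌) ↦ ModuleCat.of ℝ (ULift.{v} ℝ))
    (((TopCat.of X).toSSetObjEquiv (op ⦋1⦌)).symm σ)

/-- The elementary chain `r • σ ∈ C₁(X; ℝ)`. -/
def elementaryChain (σ : Simplex1 X) (r : ℝ) : (singularChains X).X 1 :=
  (elementaryChainHom σ).hom (ULift.up r)

/-- The finite formal sum `∑ c(σ) σ`, as an element of `C₁(X; ℝ)`. -/
def chainOf (c : Simplex1 X →₀ ℝ) : (singularChains X).X 1 :=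
  c.sum fun σ r ↦ elementaryChain σ r

/-- The chain `∑ c(σ) σ` is a cycle, and its homology class is `h`. -/
def Represents (c : Simplex1 X →₀ ℝ) (h : H1 X) : Prop :=
  ∃ z : (singularChains X).cycles 1,
    ((singularChains X).iCycles 1).hom z = chainOf c ∧
      ((singularChains X).homologyπ 1).hom z = h

end Homology

variable {E : Type u} [NormedAddCommGroup E] [NormedSpace ℝ E]
  {M : Type v} [TopologicalSpace M] [ChartedSpace E M]

/-- The coefficients, in the preferred chart `φ` at `x₀`, of a 1-form `η` on `M`: the covector field
`y ↦ (φ⁻¹)^* η` on the target of `φ`. -/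
def coeffInChart (η : ∀ x : M, TangentSpace 𝓘(ℝ, E) x →L[ℝ] ℝ) (x₀ : M) (y : E) : E →L[ℝ] ℝ :=
  (η ((chartAt E x₀).symm y)).comp
    (mfderiv 𝓘(ℝ, E) 𝓘(ℝ, E) (chartAt E x₀).symm y)

/-- `η` is a smooth closed 1-form on `M`: in charts its coefficients are smooth, and `dη = 0`, i.e.
the derivative of the coefficients is symmetric. -/
structure IsClosedForm (η : ∀ x : M, TangentSpace 𝓘(ℝ, E) x →L[ℝ] ℝ) : Prop where
  smooth : ∀ x₀ : M, ContDiffOn ℝ ∞ (coeffInChart η x₀) (chartAt E x₀).target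
  closed : ∀ x₀ : M, ∀ y ∈ (chartAt E x₀).target, ∀ u w : E,
    fderiv ℝ (coeffInChart η x₀) y u w = fderiv ℝ (coeffInChart η x₀) y w u

/-- `F` is a primitive of `η` along the (merely continuous) singular simplex `σ`: near each
parameter, `F` agrees up to a constant with `f ∘ σ` for a local primitive `f` of `η`. -/
def IsPrimitiveAlong (η : ∀ x : M, TangentSpace 𝓘(ℝ, E) x →L[ℝ] ℝ) (σ : Simplex1 M)
    (F : stdSimplex ℝ (Fin 2) → ℝ) : Prop :=
  ∀ s, ∃ U ∈ 𝓝 (σ s), ∃ f : M → ℝ,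
    (∀ x ∈ U, HasMFDerivAt 𝓘(ℝ, E) 𝓘(ℝ, ℝ) f x (η x)) ∧
      ∀ᶠ t in 𝓝 s, F t - F s = f (σ t) - f (σ s)

open Classical in
/-- The integral `∫_σ η` of a closed 1-form over a singular 1-simplex: the increment, from the
vertex `0` to the vertex `1`, of a primitive of `η` along `σ` (for closed `η` such a primitive
exists and is unique up to a constant). -/
def integralOver (η : ∀ x : M, TangentSpace 𝓘(ℝ, E) x →L[ℝ] ℝ) (σ : Simplex1 M) : ℝ :=
  if hF : ∃ F, IsPrimitiveAlong η σ F then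
    hF.choose (stdSimplex.vertex 1) - hF.choose (stdSimplex.vertex 0)
  else 0

/-! ### Closed measures and Mather's beta function -/

variable [IsManifold 𝓘(ℝ, E) ∞ M]

/-- The tangent bundle carries its Borel σ-algebra. -/
instance instMeasurableSpaceTangentBundle : MeasurableSpace (TangentBundle 𝓘(ℝ, E) M) :=
  borel _

instance instBorelSpaceTangentBundle : BorelSpace (TangentBundle 𝓘(ℝ, E) M) := ⟨rfl⟩

variable (E M) in
/-- Smooth Riemannian metrics on `M`. -/
abbrev Metric : Type (max u v) :=
  ContMDiffRiemannianMetric 𝓘(ℝ, E) ∞ E (fun x : M ↦ TangentSpace 𝓘(ℝ, E) x)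

/-- The norm `‖v‖_x` of a tangent vector `p = (x, v)`. -/
def vnorm (g : Metric E M) (p : TangentBundle 𝓘(ℝ, E) M) : ℝ :=
  √(g.inner p.1 p.2 p.2)

/-- The set `𝓜(TM)` of closed Borel probability measures on `TM` with finite first moment. -/
structure IsClosedMeasure (g : Metric E M) (μ : Measure (TangentBundle 𝓘(ℝ, E) M)) : Prop where
  prob : IsProbabilityMeasure μ
  firstMoment : Integrable (vnorm g) μ
  closed : ∀ f : M → ℝ, ContMDiff 𝓘(ℝ, E) 𝓘(ℝ, ℝ) 1 f →
    ∫ p, (mfderiv 𝓘(ℝ, E) 𝓘(ℝ, ℝ) f p.1 p.2 : ℝ) ∂μ = 0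

/-- `h ∈ H₁(M; ℝ)` is the rotation vector `ρ(μ)`: for every closed 1-form `η`, the integral
`∫ η_x(v) dμ` is the pairing of the cohomology class of `η` with `h`, i.e. the integral of `η` over
a cycle representing `h` (by Stokes' theorem, any representing cycle gives the same value). -/
def HasRotationVector (μ : Measure (TangentBundle 𝓘(ℝ, E) M)) (h : H1 M) : Prop :=
  ∃ c : Simplex1 M →₀ ℝ, Represents c h ∧
    ∀ η : ∀ x : M, TangentSpace 𝓘(ℝ, E) x →L[ℝ] ℝ, IsClosedForm η →
      ∫ p, (η p.1 p.2 : ℝ) ∂μ = c.sum fun σ r ↦ r * integralOver η σ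

/-- Tonelli Lagrangians: `C²`, with positive definite second derivative along the fibers, and
superlinear in the fibers, uniformly over `M`. -/
structure IsTonelli (g : Metric E M) (L : TangentBundle 𝓘(ℝ, E) M → ℝ) : Prop where
  contMDiff : ContMDiff 𝓘(ℝ, E).tangent 𝓘(ℝ, ℝ) 2 L
  convex : ∀ (x : M) (v w : E), w ≠ 0 →
    0 < iteratedFDeriv ℝ 2 (fun u : E ↦ L ⟨x, u⟩) v ![w, w]
  superlinear : ∀ K : ℝ, ∃ R > 0, ∀ p : TangentBundle 𝓘(ℝ, E) M,
    R ≤ vnorm g p → K ≤ L p / vnorm g p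

/-- The measures in `ρ⁻¹(h)` of finite action. A Tonelli Lagrangian on a compact manifold is bounded
below, so the action of every other measure in `ρ⁻¹(h)` is `+∞`. -/
def admissible (g : Metric E M) (L : TangentBundle 𝓘(ℝ, E) M → ℝ) (h : H1 M) :
    Set (Measure (TangentBundle 𝓘(ℝ, E) M)) :=
  {μ | IsClosedMeasure g μ ∧ HasRotationVector μ h ∧ Integrable L μ}

/-- Mather's function `β_L : H₁(M; ℝ) → ℝ`, the least action `∫ L dμ` among the closed measures `μ`
with rotation vector `h`. -/
def beta (g : Metric E M) (L : TangentBundle 𝓘(ℝ, E) M → ℝ) (h : H1 M) : ℝ :=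
  sInf ((fun μ ↦ ∫ p, L p ∂μ) '' admissible g L h)

/-- The set `𝔐_L^h` of Mather measures of rotation vector `h`. -/
def matherMeasures (g : Metric E M) (L : TangentBundle 𝓘(ℝ, E) M → ℝ) (h : H1 M) :
    Set (Measure (TangentBundle 𝓘(ℝ, E) M)) :=
  {μ ∈ admissible g L h | IsLeast ((fun ν ↦ ∫ p, L p ∂ν) '' admissible g L h) (∫ p, L p ∂μ)}

/-- The Mather set of homology class `h`: the closure of the union of the supports of all Mather
measures of rotation vector `h`. -/
def matherSet (g : Metric E M) (L : TangentBundle 𝓘(ℝ, E) M → ℝ) (h : H1 M) :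
    Set (TangentBundle 𝓘(ℝ, E) M) :=
  closure (⋃ μ ∈ matherMeasures g L h, μ.support)

/-- The perturbed Lagrangian `L_V = L + V`. -/
def perturb (L : TangentBundle 𝓘(ℝ, E) M → ℝ) (V : M → ℝ) : TangentBundle 𝓘(ℝ, E) M → ℝ :=
  fun p ↦ L p + V p.1

/-! ### The flat torus as a manifold -/

section Torus

variable (n : ℕ)

/-- The projection `ℝⁿ → 𝕋ⁿ = (ℝ/ℤ)ⁿ`. -/
def torusProj (a : EuclideanSpace ℝ (Fin n)) : UnitAddTorus (Fin n) :=
  fun i ↦ (a i : UnitAddCircle)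

lemma torusProj_surjective : Function.Surjective (torusProj n) := by
  intro x
  choose a ha using fun i ↦ QuotientAddGroup.mk_surjective (x i)
  exact ⟨WithLp.toLp 2 a, funext ha⟩

lemma torusProj_isLocalHomeomorph : IsLocalHomeomorph (torusProj n) := by
  have h : IsLocalHomeomorph (fun (a : Fin n → ℝ) (i : Fin n) ↦ (a i : UnitAddCircle)) := by
    refine IsLocalHomeomorph.mk _ fun a ↦ ?_
    have hc : IsLocalHomeomorph ((↑) : ℝ → UnitAddCircle) :=
      AddCircle.isLocalHomeomorph_coe (1 : ℝ)
    refine ⟨OpenPartialHomeomorph.pi fun i ↦ (hc.localInverseAt (a i)).symm, ?_, ?_⟩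
    · intro i _
      exact hc.self_mem_localInverseAt_target
    · intro b _
      funext i
      exact (congrFun (hc.localInverseAt_symm (a i)) (b i)).symm
  exact h.comp (EuclideanSpace.equiv (Fin n) ℝ).toHomeomorph.isLocalHomeomorph

/-- The charts of `𝕋ⁿ` are the local inverses of the projection `ℝⁿ → 𝕋ⁿ`. -/
instance instChartedSpaceTorus : ChartedSpace (EuclideanSpace ℝ (Fin n)) (UnitAddTorus (Fin n)) where
  atlas := {e | ∀ a, e.symm a = torusProj n a}
  chartAt x := (torusProj_isLocalHomeomorph n).localInverseAt (torusProj_surjective n x).choose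
  mem_chart_source x := by
    have h := (torusProj_isLocalHomeomorph n).apply_self_mem_localInverseAt_source
      (x := (torusProj_surjective n x).choose)
    rwa [(torusProj_surjective n x).choose_spec] at h
  chart_mem_atlas x a :=
    congrFun ((torusProj_isLocalHomeomorph n).localInverseAt_symm _) a

lemma torusProj_eq_iff {a b : EuclideanSpace ℝ (Fin n)} :
    torusProj n a = torusProj n b ↔ ∀ i, ∃ k : ℤ, (k : ℝ) = a i - b i := by
  rw [funext_iff]
  refine forall_congr' fun i ↦ ?_
  rw [torusProj, torusProj, ← sub_eq_zero, ← AddCircle.coe_sub, AddCircle.coe_eq_zero_iff]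
  simp

/-- A local section of the projection is locally the translation by a constant. -/
lemma torus_section_eventuallyEq
    (e : OpenPartialHomeomorph (UnitAddTorus (Fin n)) (EuclideanSpace ℝ (Fin n)))
    (he : ∀ a, e.symm a = torusProj n a) (a : EuclideanSpace ℝ (Fin n))
    (ha : torusProj n a ∈ e.source) :
    (fun b ↦ e (torusProj n b)) =ᶠ[𝓝 a] fun b ↦ b + (e (torusProj n a) - a) := by
  have hq := (torusProj_isLocalHomeomorph n).continuous
  have hc : ContinuousAt (fun b ↦ e (torusProj n b) - b) a :=
    ((e.continuousAt ha).comp hq.continuousAt).sub continuousAt_id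
  have hs : ∀ᶠ b in 𝓝 a, torusProj n b ∈ e.source :=
    hq.continuousAt.eventually (e.open_source.mem_nhds ha)
  have hi : ∀ᶠ b in 𝓝 a, ∀ i, |(e (torusProj n b) - b) i - (e (torusProj n a) - a) i| < 1 := by
    rw [eventually_all]
    intro i
    have hci : ContinuousAt (fun b ↦ (e (torusProj n b) - b) i) a :=
      (EuclideanSpace.proj i : EuclideanSpace ℝ (Fin n) →L[ℝ] ℝ).continuous.continuousAt.comp hc
    have := Metric.tendsto_nhds.1 hci 1 one_pos
    simpa only [Real.dist_eq] using this
  have hint : ∀ b, torusProj n b ∈ e.source →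
      ∀ i, ∃ k : ℤ, (k : ℝ) = (e (torusProj n b) - b) i := by
    intro b hb
    have : torusProj n (e (torusProj n b)) = torusProj n b := by rw [← he, e.left_inv hb]
    simpa using (torusProj_eq_iff n).1 this
  filter_upwards [hs, hi] with b hb hib
  have key : e (torusProj n b) - b = e (torusProj n a) - a := by
    ext i
    obtain ⟨k, hk⟩ := hint b hb i
    obtain ⟨l, hl⟩ := hint a ha i
    have h1 := hib i
    rw [← hk, ← hl] at h1 ⊢
    have h2 : |k - l| < 1 := by exact_mod_cast h1
    have h3 : k - l = 0 := Int.abs_lt_one_iff.1 h2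
    rw [sub_eq_zero.1 h3]
  rw [← key]
  abel

instance instIsManifoldTorus :
    IsManifold 𝓘(ℝ, EuclideanSpace ℝ (Fin n)) ∞ (UnitAddTorus (Fin n)) := by
  apply isManifold_of_contDiffOn
  rintro e e' he he' a ⟨ha, -⟩
  have ha' : torusProj n a ∈ e'.source := by
    rw [← he a]
    exact ha.2
  have h : (𝓘(ℝ, EuclideanSpace ℝ (Fin n)) ∘ (e.symm ≫ₕ e') ∘
      𝓘(ℝ, EuclideanSpace ℝ (Fin n)).symm) = fun b ↦ e' (torusProj n b) := by
    funext b
    simp [he b]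
  rw [h]
  exact (((contDiff_id.add contDiff_const).contDiffAt).congr_of_eventuallyEq
    (torus_section_eventuallyEq n e' he' a ha')).contDiffWithinAt

end Torus

end Mane

end

noncomputable section

namespace Mane

/-! ### Minimization of a superlinear action under linear constraints -/

section Minimization

open BoundedContinuousFunction

variable {X : Type*} [TopologicalSpace X]

variable {N L : X → ℝ}

/-! Existence of minimizers is the direct method. Superlinearity bounds the first moment of measures
of bounded action, which gives tightness, and the action is weakly lower semicontinuous. The
constraints `∫ φ dμ = r` involve unbounded integrands of linear growth; they survive weak limits
because `±φ + ε L` is bounded below for every `ε > 0` (`exists_isLeast_integral`).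

Two geometric facts make this applicable. The value of a closed form on a homology class does not
depend on the cycle (`IsClosedForm.pairing_eq`), so fixing the rotation vector is a family of linear
equations with fixed right-hand sides. Every class is realized by a closed measure on a compact set
(`exists_isClosedMeasure_hasRotationVector`): each singular simplex, which is merely continuous, is
replaced by finitely many straight chart segments carrying suitably scaled velocities.

For the comparison, `V` is bounded, so `L` and `L + V` have the same admissible measures, and the
actions differ by `∫ V dμ ≤ 0`. If the two minima agree and `μ` is a Mather measure of `L`, then
`β_{L+V} ≤ ∫ (L + V) dμ ≤ ∫ L dμ = β_L` collapses: `μ` minimizes both actions and `V` vanishes on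
its support (`mem_matherMeasures_perturb`). Conversely a single Mather measure of `L` that also
minimizes for `L + V`, with `V = 0` on its support, equates the minima.

On the torus, closed forms are constant up to exact ones, so a rotation vector sees only the mean
velocity `ρ`. By Jensen, spreading `ρ` uniformly over the torus does not raise the action of `ℓ`
(`exists_constVelocityMeasure_mem_matherMeasures`). The support of this Mather measure lies over
every point, which forces `V = 0` everywhere. -/

lemma exists_neg_le_add_mul
    (hcomp : ∀ R, IsCompact {x | N x ≤ R}) (hL : Continuous L)
    (hsup : ∀ K, ∃ R, ∀ x, R ≤ N x → K * N x ≤ L x) {φ : X → ℝ} (hφ : Continuous φ) {C : ℝ}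
    (hC : ∀ x, |φ x| ≤ C * N x) {ε : ℝ} (hε : 0 < ε) :
    ∃ B, 0 ≤ B ∧ ∀ x, -B ≤ φ x + ε * L x := by
  -- With slope `C / ε`, the term `ε * L` dominates `|φ|` where `N ≥ R`; the rest is a compact set.
  obtain ⟨R, hR⟩ := hsup (C / ε)
  obtain ⟨B, hB⟩ := ((hcomp R).image (hφ.add (continuous_const.mul hL))).bddBelow
  refine ⟨max (-B) 0, le_max_right _ _, fun x ↦ ?_⟩
  rcases le_total (N x) R with h | h
  · have h1 : B ≤ φ x + ε * L x := hB ⟨x, h, rfl⟩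
    linarith [le_max_left (-B) 0]
  · have h1 : C * N x ≤ ε * L x := by
      have := mul_le_mul_of_nonneg_left (hR x h) hε.le
      rwa [← mul_assoc, mul_div_cancel₀ _ hε.ne'] at this
    linarith [le_max_right (-B) 0, neg_le_of_abs_le (hC x)]

/-- Turns a bound on the action into a bound on the first moment, hence into tightness. -/
lemma exists_le_add_of_superlinear (hN : Continuous N)
    (hcomp : ∀ R, IsCompact {x | N x ≤ R}) (hL : Continuous L)
    (hsup : ∀ K, ∃ R, ∀ x, R ≤ N x → K * N x ≤ L x) (hN0 : ∀ x, 0 ≤ N x) :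
    ∃ B, 0 ≤ B ∧ ∀ x, N x ≤ L x + B := by
  obtain ⟨B, hB0, hB⟩ := exists_neg_le_add_mul hcomp hL hsup (φ := fun x ↦ - N x) (C := 1)
    hN.neg (fun x ↦ by rw [abs_neg, abs_of_nonneg (hN0 x), one_mul]) one_pos
  exact ⟨B, hB0, fun x ↦ by linarith [hB x]⟩

variable [MeasurableSpace X] [BorelSpace X]


/-- Truncation of a function bounded below, as a bounded continuous function. -/
def truncation (f : X → ℝ) (hf : Continuous f) (C : ℝ) (hC : ∀ x, -C ≤ f x) (k : ℕ) : X →ᵇ ℝ :=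
  BoundedContinuousFunction.ofNormedAddCommGroup (fun x ↦ min (f x) k)
    (hf.min continuous_const) (max k C) fun x ↦ by
      rw [Real.norm_eq_abs, abs_le]
      refine ⟨?_, (min_le_right _ _).trans (le_max_left _ _)⟩
      have h0 : (0 : ℝ) ≤ k := Nat.cast_nonneg k
      exact le_min ((neg_le_neg (le_max_right _ _)).trans (hC x))
        ((neg_nonpos.2 (h0.trans (le_max_left _ _))).trans h0)

/-- Monotone convergence for the nonnegative functions `min f k + C`. The right-hand side involves
only bounded continuous integrands, so it is a weakly closed condition. -/
lemma integrable_and_integral_le_iff_truncation {f : X → ℝ} (hf : Continuous f) {C : ℝ}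
    (hC0 : 0 ≤ C) (hC : ∀ x, -C ≤ f x) (c : ℝ) (μ : Measure X) [IsProbabilityMeasure μ] :
    (Integrable f μ ∧ ∫ x, f x ∂μ ≤ c) ↔ ∀ k, ∫ x, truncation f hf C hC k x ∂μ ≤ c := by
  have hint : ∀ k, Integrable (truncation f hf C hC k) μ := fun k ↦
    BoundedContinuousFunction.integrable μ _
  refine ⟨fun h k ↦ (integral_mono (hint k) h.1 fun x ↦ min_le_left _ _).trans h.2, fun h ↦ ?_⟩
  have hpos : ∀ k x, 0 ≤ truncation f hf C hC k x + C := fun k x ↦ by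
    have : -C ≤ min (f x) k := le_min (hC x) (by linarith [Nat.cast_nonneg (α := ℝ) k])
    change 0 ≤ min (f x) k + C
    linarith
  -- Needed so that `ENNReal.ofReal` loses nothing when the final inequality is read back in `ℝ`.
  have hcC : 0 ≤ c + C := by
    have h1 : 0 ≤ ∫ x, (truncation f hf C hC 0 x + C) ∂μ := integral_nonneg (hpos 0)
    rw [integral_add (hint 0) (integrable_const _)] at h1
    simp only [integral_const, probReal_univ, smul_eq_mul, one_mul] at h1
    linarith [h 0]
  have hlin : ∫⁻ x, ENNReal.ofReal (f x + C) ∂μ ≤ ENNReal.ofReal (c + C) := by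
    have ht : Tendsto (fun k : ℕ ↦ ∫⁻ x, ENNReal.ofReal (truncation f hf C hC k x + C) ∂μ) atTop
        (𝓝 (∫⁻ x, ENNReal.ofReal (f x + C) ∂μ)) := by
      refine lintegral_tendsto_of_tendsto_of_monotone (fun k ↦ ?_) (.of_forall fun x k l hkl ↦ ?_)
        (.of_forall fun x ↦ ?_)
      · exact ((truncation f hf C hC k).continuous.add
          continuous_const).measurable.ennreal_ofReal.aemeasurable
      · refine ENNReal.ofReal_le_ofReal (add_le_add_left ?_ _)
        exact min_le_min_left _ (by exact_mod_cast hkl)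
      · refine tendsto_const_nhds.congr' ?_
        obtain ⟨k, hk⟩ := exists_nat_ge (f x)
        filter_upwards [eventually_ge_atTop k] with l hl
        have : truncation f hf C hC l x = f x := min_eq_left (hk.trans (by exact_mod_cast hl))
        rw [this]
    refine le_of_tendsto' ht fun k ↦ ?_
    rw [← ofReal_integral_eq_lintegral_ofReal (f := fun x ↦ truncation f hf C hC k x + C)
      ((hint k).add (integrable_const _)) (.of_forall (hpos k)), integral_add (hint k) (integrable_const _)]
    refine ENNReal.ofReal_le_ofReal ?_
    simpa using h k
  have hpos' : ∀ x, 0 ≤ f x + C := fun x ↦ by linarith [hC x]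
  have hfC : Integrable (fun x ↦ f x + C) μ := by
    refine ⟨(hf.add continuous_const).measurable.aestronglyMeasurable, ?_⟩
    rw [hasFiniteIntegral_iff_ofReal (.of_forall hpos')]
    exact hlin.trans_lt ENNReal.ofReal_lt_top
  have hfi : Integrable f μ := by simpa [Pi.sub_def] using hfC.sub (integrable_const C)
  refine ⟨hfi, ?_⟩
  rw [← ofReal_integral_eq_lintegral_ofReal hfC (.of_forall hpos'),
    ENNReal.ofReal_le_ofReal_iff hcC, integral_add hfi (integrable_const _)] at hlin
  simpa using hlin

/-- The action is lower semicontinuous for the weak topology. -/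
lemma isClosed_setOf_integral_le {f : X → ℝ} (hf : Continuous f) {C : ℝ}
    (hC0 : 0 ≤ C) (hC : ∀ x, -C ≤ f x) (c : ℝ) :
    IsClosed {μ : ProbabilityMeasure X | Integrable f (μ : Measure X) ∧
      ∫ x, f x ∂(μ : Measure X) ≤ c} := by
  simp_rw [integrable_and_integral_le_iff_truncation hf hC0 hC, ofPred_forall]
  exact isClosed_iInter fun k ↦ isClosed_le
    (ProbabilityMeasure.continuous_integral_boundedContinuousFunction _) continuous_const

lemma integrable_of_integrable_superlinear (hN : Continuous N)
    (hcomp : ∀ R, IsCompact {x | N x ≤ R}) (hL : Continuous L)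
    (hsup : ∀ K, ∃ R, ∀ x, R ≤ N x → K * N x ≤ L x) (hN0 : ∀ x, 0 ≤ N x)
    {μ : Measure X} [IsFiniteMeasure μ] (hμ : Integrable L μ) : Integrable N μ := by
  obtain ⟨B, -, hB⟩ := exists_le_add_of_superlinear hN hcomp hL hsup hN0
  refine (hμ.add (integrable_const B)).mono' hN.measurable.aestronglyMeasurable
    (.of_forall fun x ↦ ?_)
  rw [Real.norm_eq_abs, abs_of_nonneg (hN0 x)]
  exact hB x

lemma integrable_of_abs_le_mul {φ : X → ℝ} (hφ : Continuous φ) {C : ℝ}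
    (hC : ∀ x, |φ x| ≤ C * N x) {μ : Measure X} (hμ : Integrable N μ) : Integrable φ μ :=
  (hμ.const_mul C).mono' hφ.measurable.aestronglyMeasurable (.of_forall hC)

theorem exists_isLeast_integral [T2Space X] (hN : Continuous N) (hN0 : ∀ x, 0 ≤ N x)
    (hcomp : ∀ R, IsCompact {x | N x ≤ R}) (hL : Continuous L)
    (hsup : ∀ K, ∃ R, ∀ x, R ≤ N x → K * N x ≤ L x)
    {ι : Type*} (φ : ι → X → ℝ) (hφ : ∀ i, Continuous (φ i))
    (hφN : ∀ i, ∃ C, ∀ x, |φ i x| ≤ C * N x) (r : ι → ℝ)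
    (A : Set (Measure X))
    (hA : A = {μ | IsProbabilityMeasure μ ∧ Integrable L μ ∧ ∀ i, ∫ x, φ i x ∂μ = r i})
    (hne : A.Nonempty) :
    ∃ μ ∈ A, IsLeast ((fun ν ↦ ∫ x, L x ∂ν) '' A) (∫ x, L x ∂μ) := by
  obtain ⟨B, hB0, hB⟩ := exists_le_add_of_superlinear hN hcomp hL hsup hN0
  set β := sInf ((fun ν ↦ ∫ x, L x ∂ν) '' A) with hβ
  have hbdd : BddBelow ((fun ν ↦ ∫ x, L x ∂ν) '' A) := by
    refine ⟨-B, ?_⟩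
    rintro _ ⟨ν, hν, rfl⟩
    rw [hA] at hν
    have := hν.1
    have h1 : ∫ _, -B ∂ν ≤ ∫ x, L x ∂ν :=
      integral_mono (integrable_const _) hν.2.1 fun x ↦ by
        change -B ≤ L x
        linarith [hN0 x, hB x]
    simpa using h1
  choose C hC using hφN
  have hpm : ∀ μ : ProbabilityMeasure X, IsProbabilityMeasure (μ : Measure X) := fun μ ↦ μ.2
  let S (f : X → ℝ) (c : ℝ) : Set (ProbabilityMeasure X) :=
    {μ | Integrable f (μ : Measure X) ∧ ∫ x, f x ∂(μ : Measure X) ≤ c}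
  have hSL : ∀ c, IsClosed (S L c) := fun c ↦
    isClosed_setOf_integral_le hL hB0 (fun x ↦ by linarith [hN0 x, hB x]) c
  -- The integral of `φ i` alone need not be weakly continuous. Each condition on `±φ i + ε L` is
  -- closed by lower semicontinuity, and letting `ε → 0` they pin the integral of `φ i` to `r i`.
  -- Thus `Z c` is the part of `A` with action at most `c`.
  let Z (c : ℝ) : Set (ProbabilityMeasure X) := S L c ∩ ⋂ i, ⋂ ε : Ioi (0 : ℝ),
    (S (fun x ↦ φ i x + ε * L x) (r i + ε * c) ∩ S (fun x ↦ - φ i x + ε * L x) (- r i + ε * c))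
  have hZ : ∀ c, IsClosed (Z c) := fun c ↦ by
    refine (hSL c).inter (isClosed_iInter fun i ↦ isClosed_iInter fun ε ↦ ?_)
    obtain ⟨B₁, h1, h1'⟩ := exists_neg_le_add_mul hcomp hL hsup (hφ i) (hC i) ε.2
    obtain ⟨B₂, h2, h2'⟩ := exists_neg_le_add_mul hcomp hL hsup (hφ i).neg (C := C i)
      (fun x ↦ by simpa using hC i x) ε.2
    exact (isClosed_setOf_integral_le ((hφ i).add (continuous_const.mul hL)) h1 h1' _).inter
      (isClosed_setOf_integral_le ((hφ i).neg.add (continuous_const.mul hL)) h2 h2' _)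
  have hAZ : ∀ c, ∀ μ ∈ A, ∀ hμ : IsProbabilityMeasure μ, ∫ x, L x ∂μ ≤ c →
      (⟨μ, hμ⟩ : ProbabilityMeasure X) ∈ Z c := by
    intro c μ hμA hμ hc
    rw [hA] at hμA
    obtain ⟨-, hLi, hr⟩ := hμA
    have hNi := integrable_of_integrable_superlinear hN hcomp hL hsup hN0 hLi
    refine ⟨⟨hLi, hc⟩, mem_iInter.2 fun i ↦ mem_iInter.2 fun ε ↦ ?_⟩
    have hφi := integrable_of_abs_le_mul (hφ i) (hC i) hNi
    have hε : (0 : ℝ) < ε := ε.2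
    have hmul := mul_le_mul_of_nonneg_left hc hε.le
    refine ⟨⟨hφi.add (hLi.const_mul _), ?_⟩, ⟨hφi.neg.add (hLi.const_mul _), ?_⟩⟩
    · change ∫ x, (φ i x + ε * L x) ∂μ ≤ _
      rw [integral_add hφi (hLi.const_mul _), integral_const_mul, hr i]
      linarith
    · change ∫ x, (- φ i x + ε * L x) ∂μ ≤ _
      rw [integral_add (f := fun x ↦ - φ i x) hφi.neg (hLi.const_mul _), integral_const_mul, integral_neg, hr i]
      linarith
  have hZA : ∀ μ : ProbabilityMeasure X, ∀ c, μ ∈ Z c → (μ : Measure X) ∈ A := by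
    rintro μ c ⟨⟨hLi, hc⟩, hμ⟩
    rw [hA]
    refine ⟨hpm μ, hLi, fun i ↦ ?_⟩
    have hNi := integrable_of_integrable_superlinear hN hcomp hL hsup hN0 hLi
    have hφi := integrable_of_abs_le_mul (hφ i) (hC i) hNi
    have key : ∀ s : ℝ, (∀ ε > 0, s + ε * ∫ x, L x ∂(μ : Measure X) ≤ ε * c) → s ≤ 0 := by
      intro s hs
      have h1 : Tendsto (fun ε : ℝ ↦ ε * (c - ∫ x, L x ∂(μ : Measure X))) (𝓝[>] 0) (𝓝 0) := by
        have : Continuous fun ε : ℝ ↦ ε * (c - ∫ x, L x ∂(μ : Measure X)) := by fun_prop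
        simpa using (this.tendsto 0).mono_left nhdsWithin_le_nhds
      refine ge_of_tendsto h1 ?_
      filter_upwards [self_mem_nhdsWithin] with ε hε
      linarith [hs ε hε]
    have hmem := fun ε : Ioi (0 : ℝ) ↦ mem_iInter.1 (mem_iInter.1 hμ i) ε
    have h1 : ∫ x, φ i x ∂(μ : Measure X) - r i ≤ 0 := key _ fun ε hε ↦ by
      have h := (hmem ⟨ε, hε⟩).1.2
      change ∫ x, (φ i x + ε * L x) ∂(μ : Measure X) ≤ r i + ε * c at h
      rw [integral_add hφi (hLi.const_mul _), integral_const_mul] at h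
      linarith
    have h2 : r i - ∫ x, φ i x ∂(μ : Measure X) ≤ 0 := key _ fun ε hε ↦ by
      have h := (hmem ⟨ε, hε⟩).2.2
      change ∫ x, (- φ i x + ε * L x) ∂(μ : Measure X) ≤ - r i + ε * c at h
      rw [integral_add (f := fun x ↦ - φ i x) hφi.neg (hLi.const_mul _), integral_const_mul, integral_neg] at h
      linarith
    linarith
  -- A tight family, compact by Prokhorov. The bounds are Markov's inequality for `∫ N ≤ ∫ L + B ≤ β
  -- + 1 + B`.
  let T : Set (ProbabilityMeasure X) :=
    {μ | ∀ n : ℕ, μ {x | N x ≤ n + 1}ᶜ ≤ Real.toNNReal ((β + 1 + B) * (1 / (n + 1)))}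
  have hT : IsCompact T := by
    refine isCompact_setOfPred_probabilityMeasure_mass_eq_compl_isCompact_le ?_
      (fun n ↦ hcomp (n + 1)) (Or.inr fun m n hmn x hx ↦ ?_)
    · have h1 : Tendsto (fun n : ℕ ↦ (β + 1 + B) * (1 / ((n : ℝ) + 1))) atTop (𝓝 0) := by
        simpa using tendsto_const_nhds.mul (tendsto_one_div_add_atTop_nhds_zero_nat (𝕜 := ℝ))
      simpa only [Real.toNNReal_zero, Function.comp_def] using
        (continuous_real_toNNReal.tendsto 0).comp h1
    · have h1 : (m : ℝ) ≤ n := by exact_mod_cast hmn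
      exact le_trans (show N x ≤ m + 1 from hx) (by linarith)
  have hZT : ∀ c ≤ β + 1, Z c ⊆ T := by
    rintro c hc μ ⟨⟨hLi, hLc⟩, -⟩ n
    have hNi := integrable_of_integrable_superlinear hN hcomp hL hsup hN0 hLi
    have hn' : (0 : ℝ) < n + 1 := by positivity
    have h1 : ∫ x, N x ∂(μ : Measure X) ≤ β + 1 + B := by
      have : ∫ x, N x ∂(μ : Measure X) ≤ ∫ x, (L x + B) ∂(μ : Measure X) :=
        integral_mono hNi (hLi.add (integrable_const _)) hB
      rw [integral_add hLi (integrable_const _)] at this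
      simp only [integral_const, probReal_univ, smul_eq_mul, one_mul] at this
      linarith
    have h2 := mul_meas_ge_le_integral_of_nonneg (μ := (μ : Measure X)) (.of_forall hN0) hNi (n + 1)
    rw [← NNReal.coe_le_coe]
    refine le_trans ?_ (Real.le_coe_toNNReal _)
    rw [mul_one_div, le_div_iff₀ hn', mul_comm]
    refine le_trans (mul_le_mul_of_nonneg_left ?_ hn'.le) (h2.trans h1)
    change (μ : Measure X).real _ ≤ _
    refine measureReal_mono fun x hx ↦ ?_
    have : ¬ N x ≤ n + 1 := hx
    exact (not_le.1 this).le
  have hex : ∀ c > β, (Z c).Nonempty := by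
    intro c hc
    obtain ⟨_, ⟨μ, hμ, rfl⟩, hlt⟩ := exists_lt_of_csInf_lt (hne.image _) hc
    have hp : IsProbabilityMeasure μ := by rw [hA] at hμ; exact hμ.1
    exact ⟨⟨μ, hp⟩, hAZ c μ hμ hp hlt.le⟩
  have hmono : ∀ c d, c ≤ d → Z c ⊆ Z d := by
    intro c d hcd μ hμ
    exact hAZ d μ (hZA μ c hμ) μ.2 (hμ.1.2.trans hcd)
  -- Nested nonempty closed subsets of a compact set; a common point has action at most `β`.
  obtain ⟨μ, hμT, hμ⟩ : (T ∩ ⋂ n : ℕ, Z (β + 1 / (n + 1))).Nonempty := by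
    refine hT.inter_iInter_nonempty _ (fun n ↦ hZ _) fun u ↦ ?_
    obtain ⟨m, hm⟩ := u.bddAbove
    obtain ⟨μ, hμ⟩ := hex (β + 1 / (m + 1)) (by linarith [Nat.one_div_pos_of_nat (α := ℝ) (n := m)])
    refine ⟨μ, hZT _ ?_ hμ, mem_iInter₂.2 fun n hn ↦ hmono _ _ ?_ hμ⟩
    · have : 1 / ((m : ℝ) + 1) ≤ 1 := by
        rw [div_le_one (by positivity)]
        linarith [Nat.cast_nonneg (α := ℝ) m]
      linarith
    · linarith [Nat.one_div_le_one_div (α := ℝ) (hm hn)]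
  have hμA := hZA μ _ (mem_iInter.1 hμ 0)
  refine ⟨μ, hμA, ⟨μ, hμA, rfl⟩, fun y hy ↦ le_trans ?_ (csInf_le hbdd hy)⟩
  refine ge_of_tendsto' (f := fun n : ℕ ↦ β + 1 / ((n : ℝ) + 1)) (x := atTop) ?_
    fun n ↦ (mem_iInter.1 hμ n).1.2
  simpa using tendsto_const_nhds.add (tendsto_one_div_add_atTop_nhds_zero_nat (𝕜 := ℝ))

end Minimization

/-! ### Linear functionals on singular chains -/

section Chains

open CategoryTheory CategoryTheory.Limits AlgebraicTopology Opposite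
open scoped Simplicial

variable {X : Type v} [TopologicalSpace X]

/-- The coefficient module `ℝ`. -/
abbrev coeffModule : ModuleCat.{v} ℝ := ModuleCat.of ℝ (ULift.{v} ℝ)

/-- The inclusion of the summand of `Cₙ(X; ℝ)` indexed by the singular simplex `σ`. -/
def simplexHom (n : ℕ) (σ : C(stdSimplex ℝ (Fin (n + 1)), X)) :
    coeffModule.{v} ⟶ (singularChains X).X n :=
  (TopCat.toSSet.obj (TopCat.of X)).ιChainComplex
    (((TopCat.of X).toSSetObjEquiv (op ⦋n⦌)).symm σ)

lemma chains_hom_ext {n : ℕ} {T : ModuleCat.{v} ℝ} {F G : (singularChains X).X n ⟶ T}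
    (h : ∀ σ, simplexHom n σ ≫ F = simplexHom n σ ≫ G) : F = G := by
  refine SSet.chainComplex_hom_ext fun x ↦ ?_
  have := h ((TopCat.of X).toSSetObjEquiv (op ⦋n⦌) x)
  simp only [simplexHom, Equiv.symm_apply_apply] at this
  exact this

/-- The `i`-th face of a singular simplex. -/
def face {n : ℕ} (i : Fin (n + 2)) (σ : C(stdSimplex ℝ (Fin (n + 2)), X)) :
    C(stdSimplex ℝ (Fin (n + 1)), X) :=
  σ.comp ⟨stdSimplex.map (Fin.succAbove i), stdSimplex.continuous_map _⟩

lemma simplexHom_d {n : ℕ} (σ : C(stdSimplex ℝ (Fin (n + 2)), X)) :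
    simplexHom (n + 1) σ ≫ (singularChains X).d (n + 1) n =
      ∑ i : Fin (n + 2), (-1 : ℤ) ^ i.val • simplexHom n (face i σ) := by
  refine (SSet.ιChainComplex_d _ _ _).trans ?_
  rfl

/-- The linear functional on `Cₙ(X; ℝ)` with prescribed values on the singular simplices. -/
def chainPairing (n : ℕ) (I : C(stdSimplex ℝ (Fin (n + 1)), X) → ℝ) :
    (singularChains X).X n ⟶ coeffModule.{v} :=
  Cofan.IsColimit.desc ((TopCat.toSSet.obj (TopCat.of X)).isColimitChainComplexXCofan _ n)
    fun x ↦ I ((TopCat.of X).toSSetObjEquiv (op ⦋n⦌) x) • 𝟙 _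

lemma simplexHom_chainPairing {n : ℕ} (I : C(stdSimplex ℝ (Fin (n + 1)), X) → ℝ)
    (σ : C(stdSimplex ℝ (Fin (n + 1)), X)) :
    simplexHom n σ ≫ chainPairing n I = I σ • 𝟙 _ := by
  refine (Cofan.IsColimit.fac
    ((TopCat.toSSet.obj (TopCat.of X)).isColimitChainComplexXCofan _ n) _ _).trans ?_
  rw [Equiv.apply_symm_apply]

lemma chainPairing_chainOf (I : Simplex1 X → ℝ) (c : Simplex1 X →₀ ℝ) :
    (chainPairing 1 I).hom (chainOf c) = ULift.up (c.sum fun σ r ↦ r * I σ) := by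
  have h : ∀ σ r, (chainPairing 1 I).hom (elementaryChain σ r) = ULift.up (r * I σ) := by
    intro σ r
    have := congrArg (fun F ↦ F.hom (ULift.up r)) (simplexHom_chainPairing I σ)
    refine Eq.trans this ?_
    ext
    simp [mul_comm]
  rw [chainOf, Finsupp.sum, map_sum]
  simp_rw [h]
  ext
  rw [Finsupp.sum]
  exact (map_sum (ULift.moduleEquiv (R := ℝ) (M := ℝ)) _ _)

lemma chainOf_add (c d : Simplex1 X →₀ ℝ) : chainOf (c + d) = chainOf c + chainOf d :=
  Finsupp.sum_add_index' (fun σ ↦ map_zero (elementaryChainHom σ).hom)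
    fun σ r s ↦ map_add (elementaryChainHom σ).hom (ULift.up r) (ULift.up s)

/-- The quotient map by the span of the elementary chains vanishes on every summand, hence is zero.
-/
lemma exists_chainOf_eq (z : (singularChains X).X 1) : ∃ c, chainOf c = z := by
  let S : Submodule ℝ ((singularChains X).X 1) := ⨆ σ, LinearMap.range (elementaryChainHom σ).hom
  have hS : ModuleCat.ofHom S.mkQ = 0 := by
    refine chains_hom_ext fun σ ↦ ?_
    ext
    simp only [comp_zero]
    refine (Submodule.Quotient.mk_eq_zero _).2 ?_
    exact le_iSup (fun σ ↦ LinearMap.range (elementaryChainHom σ).hom) σ ⟨_, rfl⟩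
  have hz : z ∈ S := by
    rw [← Submodule.Quotient.mk_eq_zero]
    exact congrArg (fun F ↦ F.hom z) hS
  induction hz using Submodule.iSup_induction' with
  | mem σ x hx =>
    obtain ⟨⟨r⟩, rfl⟩ := hx
    exact ⟨Finsupp.single σ r, Finsupp.sum_single_index (map_zero (elementaryChainHom σ).hom)⟩
  | zero => exact ⟨0, Finsupp.sum_zero_index⟩
  | add x y _ _ hx hy =>
    obtain ⟨c, rfl⟩ := hx
    obtain ⟨d, rfl⟩ := hy
    exact ⟨c + d, chainOf_add c d⟩

lemma exists_represents (h : H1 X) : ∃ c, Represents c h := by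
  have hs : Function.Surjective ((singularChains X).homologyπ 1).hom :=
    (ModuleCat.epi_iff_surjective _).1 inferInstance
  obtain ⟨z, hz⟩ := hs h
  obtain ⟨c, hc⟩ := exists_chainOf_eq (((singularChains X).iCycles 1).hom z)
  exact ⟨c, z, hc.symm, hz⟩

/-- The coefficients pair `c` with the coboundary of the 0-cochain `f`, and a cycle is killed by
coboundaries. This is what makes the measure built from a cycle closed. -/
lemma Represents.sum_boundary {c : Simplex1 X →₀ ℝ} {h : H1 X} (hc : Represents c h)
    (f : X → ℝ) :
    (c.sum fun σ r ↦ r * (f (σ (stdSimplex.vertex 1)) - f (σ (stdSimplex.vertex 0)))) = 0 := by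
  obtain ⟨z, hz, -⟩ := hc
  have h1 : (singularChains X).d 1 0 ≫ chainPairing 0 (fun σ ↦ f (σ (stdSimplex.vertex 0))) =
      chainPairing 1
        (fun σ ↦ f (σ (stdSimplex.vertex 1)) - f (σ (stdSimplex.vertex 0))) := by
    refine chains_hom_ext fun σ ↦ ?_
    rw [← Category.assoc, simplexHom_d, Preadditive.sum_comp, Fin.sum_univ_two,
      simplexHom_chainPairing]
    simp only [Preadditive.zsmul_comp]
    simp only [simplexHom_chainPairing, Fin.val_zero, Fin.val_one, pow_zero,
      pow_one, one_smul, neg_smul, face, ContinuousMap.comp_apply, ContinuousMap.coe_mk,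
      stdSimplex.map_vertex, Fin.succAbove_zero, Fin.succ_zero_eq_one, sub_eq_add_neg, add_smul]
    rfl
  have h2 : ((singularChains X).d 1 0).hom (((singularChains X).iCycles 1).hom z) = 0 :=
    congrArg (fun F ↦ F.hom z) ((singularChains X).iCycles_d 1 0)
  have h3 := congrArg (fun F ↦ F.hom (((singularChains X).iCycles 1).hom z)) h1
  have h4 : (chainPairing 1 (fun σ : Simplex1 X ↦
      f (σ (stdSimplex.vertex 1)) - f (σ (stdSimplex.vertex 0)))).hom (chainOf c) = 0 := by
    rw [← hz]
    refine h3.symm.trans ?_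
    rw [ModuleCat.hom_comp, LinearMap.comp_apply, h2, map_zero]
  rw [chainPairing_chainOf] at h4
  exact congrArg ULift.down h4

/-- A cocycle kills boundaries, so on cycles it factors through homology, which is the cokernel of
`toCycles`. -/
lemma Represents.sum_eq_of_cocycle {c c' : Simplex1 X →₀ ℝ} {h : H1 X} (hc : Represents c h)
    (hc' : Represents c' h) (I : Simplex1 X → ℝ)
    (hI : ∀ τ : C(stdSimplex ℝ (Fin 3), X), I (face 0 τ) - I (face 1 τ) + I (face 2 τ) = 0) :
    (c.sum fun σ r ↦ r * I σ) = c'.sum fun σ r ↦ r * I σ := by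
  obtain ⟨z, hz, hzh⟩ := hc
  obtain ⟨z', hz', hzh'⟩ := hc'
  have h1 : (singularChains X).d 2 1 ≫ chainPairing 1 I = 0 := by
    refine chains_hom_ext fun τ ↦ ?_
    rw [← Category.assoc, simplexHom_d, Preadditive.sum_comp, Fin.sum_univ_three, comp_zero]
    simp only [Preadditive.zsmul_comp]
    simp only [simplexHom_chainPairing]
    simp only [Fin.val_zero, Fin.val_one, Fin.val_two, pow_zero, pow_one, one_smul, neg_smul,
      even_two.neg_one_pow]
    rw [← sub_eq_add_neg, ← sub_smul, ← add_smul, hI, zero_smul]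
  have h2 : (singularChains X).toCycles 2 1 ≫
      ((singularChains X).iCycles 1 ≫ chainPairing 1 I) = 0 := by
    rw [← Category.assoc, HomologicalComplex.toCycles_i, h1]
  have hG := (singularChains X).homologyIsCokernel 2 1 (by simp)
  have h3 : (singularChains X).homologyπ 1 ≫
      hG.desc (CokernelCofork.ofπ _ h2) = (singularChains X).iCycles 1 ≫ chainPairing 1 I :=
    hG.fac (CokernelCofork.ofπ _ h2) WalkingParallelPair.one
  have h4 : ∀ w, (chainPairing 1 I).hom (((singularChains X).iCycles 1).hom w) =
      (hG.desc (CokernelCofork.ofπ _ h2)).hom (((singularChains X).homologyπ 1).hom w) :=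
    fun w ↦ (congrArg (fun F ↦ F.hom w) h3).symm
  have h5 : (chainPairing 1 I).hom (chainOf c) = (chainPairing 1 I).hom (chainOf c') := by
    rw [← hz, ← hz', h4, h4, hzh, hzh']
  rw [chainPairing_chainOf, chainPairing_chainOf] at h5
  exact congrArg ULift.down h5

end Chains

/-! ### Primitives of closed forms -/

section Primitives

/-- Having equal increments is a symmetric and transitive relation between parameters; on a
connected set it only has to hold locally. -/
lemma sub_eq_sub_of_locally {T : Type*} [TopologicalSpace T] {A : Set T} (hA : IsPreconnected A)
    {F G : T → ℝ} (h : ∀ s ∈ A, ∀ᶠ t in 𝓝[A] s, F t - F s = G t - G s) {s t : T}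
    (hs : s ∈ A) (ht : t ∈ A) : F t - F s = G t - G s := by
  refine hA.induction₂ (fun s t ↦ F t - F s = G t - G s) h ?_ ?_ hs ht
  · intro x y z _ _ _ h1 h2
    linarith
  · intro x y _ _ h1
    linarith

lemma isPreconnected_preimage_val {W : Type*} [NormedAddCommGroup W] [NormedSpace ℝ W]
    {K : Set W} (hK : Convex ℝ K) {B : Set W} (hB : Convex ℝ B) :
    IsPreconnected ((↑) ⁻¹' B : Set K) := by
  rw [← Topology.IsInducing.subtypeVal.isPreconnected_image, Subtype.image_preimage_coe]
  exact (hK.inter hB).isPreconnected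

variable {E : Type u} [NormedAddCommGroup E] [NormedSpace ℝ E]
  {M : Type v} [TopologicalSpace M] [ChartedSpace E M] [IsManifold 𝓘(ℝ, E) ∞ M]
  {η : ∀ x : M, TangentSpace 𝓘(ℝ, E) x →L[ℝ] ℝ}

lemma hasMFDerivAt_chartAt_symm (x₀ : M) {y : E} (hy : y ∈ (chartAt E x₀).target) :
    HasMFDerivAt 𝓘(ℝ, E) 𝓘(ℝ, E) (chartAt E x₀).symm y
      (mfderiv 𝓘(ℝ, E) 𝓘(ℝ, E) (chartAt E x₀).symm y) := by
  have : IsManifold 𝓘(ℝ, E) 1 M := IsManifold.of_le (n := ∞) (by simp)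
  exact ((mdifferentiable_chart (I := 𝓘(ℝ, E)) x₀).mdifferentiableAt_symm hy).hasMFDerivAt

lemma hasFDerivAt_comp_chartAt_symm {f : M → ℝ} (x₀ : M) {y : E}
    (hy : y ∈ (chartAt E x₀).target)
    (hf : HasMFDerivAt 𝓘(ℝ, E) 𝓘(ℝ, ℝ) f ((chartAt E x₀).symm y) (η ((chartAt E x₀).symm y))) :
    HasFDerivAt (f ∘ (chartAt E x₀).symm) (coeffInChart η x₀ y) y :=
  (hf.comp y (hasMFDerivAt_chartAt_symm x₀ hy)).hasFDerivAt

lemma hasMFDerivAt_comp_chartAt {f : E → ℝ} (x₀ : M) {x : M} (hx : x ∈ (chartAt E x₀).source)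
    (hf : HasFDerivAt f (coeffInChart η x₀ (chartAt E x₀ x)) (chartAt E x₀ x)) :
    HasMFDerivAt 𝓘(ℝ, E) 𝓘(ℝ, ℝ) (f ∘ chartAt E x₀) x (η x) := by
  have : IsManifold 𝓘(ℝ, E) 1 M := IsManifold.of_le (n := ∞) (by simp)
  have hm := mdifferentiable_chart (I := 𝓘(ℝ, E)) x₀
  have h := hf.hasMFDerivAt.comp x (hm.mdifferentiableAt hx).hasMFDerivAt
  have h1 := hm.symm_comp_deriv hx
  have h2 : ∀ v, mfderiv 𝓘(ℝ, E) 𝓘(ℝ, E) (chartAt E x₀).symm (chartAt E x₀ x)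
      (mfderiv 𝓘(ℝ, E) 𝓘(ℝ, E) (chartAt E x₀) x v) = v := fun v ↦ congrArg (fun A ↦ A v) h1
  -- All tangent spaces are definitionally `E`, so the base point can be moved along an equality
  -- without a cast on the vector.
  have h3 : ∀ z, z = x → ∀ w : E, η z w = η x w := by
    rintro z rfl w
    rfl
  have h4 : (coeffInChart η x₀ (chartAt E x₀ x)).comp
      (mfderiv 𝓘(ℝ, E) 𝓘(ℝ, E) (chartAt E x₀) x) = η x := by
    ext v
    exact (h3 _ ((chartAt E x₀).left_inv hx) _).trans (congrArg (η x) (h2 v))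
  exact h4 ▸ h

lemma exists_ball_subset_target (E : Type*) [NormedAddCommGroup E] {M : Type*} [TopologicalSpace M]
    [ChartedSpace E M] (x₀ : M) :
    ∃ r > 0, Metric.ball (chartAt E x₀ x₀) r ⊆ (chartAt E x₀).target :=
  Metric.isOpen_iff.1 (chartAt E x₀).open_target _ (mem_chart_target E x₀)

/-- The domain of the chart at `x₀` restricted to a ball. -/
def chartBall (E : Type*) [NormedAddCommGroup E] {M : Type*} [TopologicalSpace M]
    [ChartedSpace E M] (x₀ : M) (r : ℝ) : Set M :=
  (chartAt E x₀).source ∩ chartAt E x₀ ⁻¹' Metric.ball (chartAt E x₀ x₀) r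

omit [NormedSpace ℝ E] [IsManifold 𝓘(ℝ, E) ∞ M] in
lemma chartBall_mem_nhds (x₀ : M) {r : ℝ} (hr : 0 < r) : chartBall E x₀ r ∈ 𝓝 x₀ :=
  ((chartAt E x₀).isOpen_inter_preimage Metric.isOpen_ball).mem_nhds
    ⟨mem_chart_source E x₀, Metric.mem_ball_self hr⟩

/-- Poincaré's lemma. -/
lemma IsClosedForm.exists_primitive (hη : IsClosedForm η) (x₀ : M) {r : ℝ}
    (hr : Metric.ball (chartAt E x₀ x₀) r ⊆ (chartAt E x₀).target) :
    ∃ f : M → ℝ, ∀ x ∈ chartBall E x₀ r, HasMFDerivAt 𝓘(ℝ, E) 𝓘(ℝ, ℝ) f x (η x) := by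
  obtain ⟨f, hf⟩ := (convex_ball (chartAt E x₀ x₀) r).exists_forall_hasFDerivAt_of_fderiv_symmetric
    Metric.isOpen_ball (((hη.smooth x₀).mono hr).differentiableOn (by simp))
    fun a ha u w ↦ hη.closed x₀ a (hr ha) u w
  exact ⟨f ∘ chartAt E x₀, fun x hx ↦ hasMFDerivAt_comp_chartAt x₀ hx.1 (hf _ hx.2)⟩

/-- In a chart the difference of the two primitives has zero derivative on a ball, hence is constant
there. -/
lemma eventually_sub_eq_sub {f f' : M → ℝ} {x : M}
    (hf : ∀ᶠ y in 𝓝 x, HasMFDerivAt 𝓘(ℝ, E) 𝓘(ℝ, ℝ) f y (η y))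
    (hf' : ∀ᶠ y in 𝓝 x, HasMFDerivAt 𝓘(ℝ, E) 𝓘(ℝ, ℝ) f' y (η y)) :
    ∀ᶠ y in 𝓝 x, f y - f x = f' y - f' x := by
  have hx := mem_chart_source E x
  have hs : ContinuousAt (chartAt E x).symm (chartAt E x x) :=
    (chartAt E x).continuousAt_symm (mem_chart_target E x)
  have h1 : ∀ᶠ y in 𝓝 (chartAt E x x), y ∈ (chartAt E x).target ∧
      HasMFDerivAt 𝓘(ℝ, E) 𝓘(ℝ, ℝ) f ((chartAt E x).symm y) (η ((chartAt E x).symm y)) ∧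
      HasMFDerivAt 𝓘(ℝ, E) 𝓘(ℝ, ℝ) f' ((chartAt E x).symm y) (η ((chartAt E x).symm y)) := by
    refine (show ∀ᶠ y in 𝓝 (chartAt E x x), y ∈ (chartAt E x).target from
      (chartAt E x).open_target.mem_nhds (mem_chart_target E x)).and ?_
    have h0 : ∀ᶠ z in 𝓝 ((chartAt E x).symm (chartAt E x x)),
        HasMFDerivAt 𝓘(ℝ, E) 𝓘(ℝ, ℝ) f z (η z) ∧ HasMFDerivAt 𝓘(ℝ, E) 𝓘(ℝ, ℝ) f' z (η z) := by
      rw [(chartAt E x).left_inv hx]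
      exact hf.and hf'
    exact hs.eventually h0
  obtain ⟨r, hr, hball⟩ := Metric.mem_nhds_iff.1 h1
  filter_upwards [chartBall_mem_nhds (E := E) x hr] with y hy
  have hd : ∀ z ∈ Metric.ball (chartAt E x x) r,
      HasFDerivAt (fun z ↦ f ((chartAt E x).symm z) - f' ((chartAt E x).symm z))
        (0 : E →L[ℝ] ℝ) z := by
    intro z hz
    obtain ⟨hz1, hz2, hz3⟩ := hball hz
    have := (hasFDerivAt_comp_chartAt_symm x hz1 hz2).sub (hasFDerivAt_comp_chartAt_symm x hz1 hz3)
    rwa [sub_self] at this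
  have h2 := (convex_ball (chartAt E x x) r).is_const_of_fderivWithin_eq_zero (𝕜 := ℝ)
    (fun z hz ↦ (hd z hz).differentiableAt.differentiableWithinAt)
    (fun z hz ↦ (hd z hz).hasFDerivWithinAt.fderivWithin
      (Metric.isOpen_ball.uniqueDiffWithinAt hz)) hy.2 (Metric.mem_ball_self hr)
  rw [(chartAt E x).left_inv hx, (chartAt E x).left_inv hy.1] at h2
  linarith

/-- `F` is a primitive of `η` along the map `σ`. -/
def IsPrimitiveOver {T : Type*} [TopologicalSpace T]
    (η : ∀ x : M, TangentSpace 𝓘(ℝ, E) x →L[ℝ] ℝ) (σ : T → M) (F : T → ℝ) : Prop :=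
  ∀ s, ∃ U ∈ 𝓝 (σ s), ∃ f : M → ℝ,
    (∀ x ∈ U, HasMFDerivAt 𝓘(ℝ, E) 𝓘(ℝ, ℝ) f x (η x)) ∧
      ∀ᶠ t in 𝓝 s, F t - F s = f (σ t) - f (σ s)

omit [IsManifold 𝓘(ℝ, E) ∞ M] in
lemma IsPrimitiveOver.comp {T S : Type*} [TopologicalSpace T] [TopologicalSpace S] {σ : T → M}
    {F : T → ℝ} (hF : IsPrimitiveOver η σ F) {a : S → T} (ha : Continuous a) :
    IsPrimitiveOver η (σ ∘ a) (F ∘ a) := by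
  intro s
  obtain ⟨U, hU, f, hf, h⟩ := hF (a s)
  exact ⟨U, hU, f, hf, ha.continuousAt.eventually h⟩

/-- Lets a chart segment replace a piece of a merely continuous path inside one chart ball: both are
measured by the same local primitive. -/
lemma IsPrimitiveOver.sub_eq_of_mapsTo {T : Type*} [TopologicalSpace T] {σ : T → M} {F : T → ℝ}
    (hF : IsPrimitiveOver η σ F) (hσ : Continuous σ) {U : Set M} {f : M → ℝ}
    (hU : ∀ x ∈ U, U ∈ 𝓝 x) (hf : ∀ x ∈ U, HasMFDerivAt 𝓘(ℝ, E) 𝓘(ℝ, ℝ) f x (η x))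
    {A : Set T} (hA : IsPreconnected A) (hAU : MapsTo σ A U) {s t : T} (hs : s ∈ A) (ht : t ∈ A) :
    F t - F s = f (σ t) - f (σ s) := by
  refine sub_eq_sub_of_locally (G := f ∘ σ) hA (fun s hs ↦ ?_) hs ht
  obtain ⟨U', hU', f', hf', h⟩ := hF s
  have h1 := eventually_sub_eq_sub (mem_of_superset (hU _ (hAU hs)) hf) (mem_of_superset hU' hf')
  filter_upwards [mem_nhdsWithin_of_mem_nhds h,
    mem_nhdsWithin_of_mem_nhds (hσ.continuousAt.eventually h1)] with t ht ht'
  rw [ht]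
  exact ht'.symm

/-- Makes the arbitrary choice in `integralOver` harmless. -/
lemma IsPrimitiveOver.sub_eq_sub {T : Type*} [TopologicalSpace T] [PreconnectedSpace T]
    {σ : T → M} {F F' : T → ℝ} (hF : IsPrimitiveOver η σ F) (hF' : IsPrimitiveOver η σ F')
    (hσ : Continuous σ) (s t : T) : F t - F s = F' t - F' s := by
  refine sub_eq_sub_of_locally isPreconnected_univ (fun s _ ↦ ?_) (mem_univ s) (mem_univ t)
  rw [nhdsWithin_univ]
  obtain ⟨U, hU, f, hf, h⟩ := hF s
  obtain ⟨U', hU', f', hf', h'⟩ := hF' s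
  have h1 := eventually_sub_eq_sub (mem_of_superset hU hf) (mem_of_superset hU' hf')
  filter_upwards [h, h', hσ.continuousAt.eventually h1] with t ht ht' ht''
  rw [ht, ht', ht'']

/-- A closed form has a primitive along every map defined on a compact convex set. -/
theorem IsClosedForm.exists_isPrimitiveOver (hη : IsClosedForm η) {W : Type*}
    [NormedAddCommGroup W] [NormedSpace ℝ W] {K : Set W} (hK : Convex ℝ K) (hKc : IsCompact K)
    (σ : C(K, M)) : ∃ F, IsPrimitiveOver η σ F := by
  rcases K.eq_empty_or_nonempty with rfl | ⟨x₀, hx₀⟩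
  · exact ⟨fun _ ↦ 0, fun s ↦ s.2.elim⟩
  have : CompactSpace K := isCompact_iff_compactSpace.1 hKc
  have hloc : ∀ x : M, ∃ U : Set M, IsOpen U ∧ x ∈ U ∧ ∃ f : M → ℝ,
      ∀ y ∈ U, HasMFDerivAt 𝓘(ℝ, E) 𝓘(ℝ, ℝ) f y (η y) := by
    intro x
    obtain ⟨r, hr, hball⟩ := exists_ball_subset_target E x
    obtain ⟨f, hf⟩ := hη.exists_primitive x hball
    exact ⟨chartBall E x r, (chartAt E x).isOpen_inter_preimage Metric.isOpen_ball,
      mem_of_mem_nhds (chartBall_mem_nhds x hr), f, hf⟩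
  choose U hUo hxU f hf using hloc
  obtain ⟨δ, hδ, hleb⟩ := lebesgue_number_lemma_of_metric (s := (univ : Set K))
    (c := fun x : M ↦ σ ⁻¹' U x) isCompact_univ (fun x ↦ (hUo x).preimage σ.continuous)
    fun s _ ↦ mem_iUnion.2 ⟨σ s, hxU _⟩
  choose i hi using fun a ↦ hleb a (mem_univ a)
  replace hi : ∀ a b : K, dist b a < δ → σ b ∈ U (i a) := fun a b hab ↦ hi a hab
  -- `G a` is a local primitive along `σ` on the `δ`-ball around `a`, where `δ` is a Lebesgue
  -- number. Two balls meet in a convex, hence connected, part of `K`, so there the increments of `G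
  -- a` and `G a'` agree.
  let G : K → K → ℝ := fun a b ↦ f (i a) (σ b)
  have hG : ∀ a a' b c : K, dist b a < δ → dist b a' < δ → dist c a < δ → dist c a' < δ →
      G a b - G a c = G a' b - G a' c := by
    intro a a' b c h1 h2 h3 h4
    refine sub_eq_sub_of_locally (T := K) (A := (↑) ⁻¹' (Metric.ball (a : W) δ ∩ Metric.ball a' δ))
      (isPreconnected_preimage_val hK ((convex_ball _ _).inter (convex_ball _ _)))
      (fun s hs ↦ ?_) ⟨h3, h4⟩ ⟨h1, h2⟩
    have := eventually_sub_eq_sub (mem_of_superset ((hUo _).mem_nhds (hi a s hs.1)) (hf (i a)))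
      (mem_of_superset ((hUo _).mem_nhds (hi a' s hs.2)) (hf (i a')))
    exact mem_nhdsWithin_of_mem_nhds (σ.continuous.continuousAt.eventually this)
  obtain ⟨D, hD⟩ := (Metric.isBounded_iff.1 hKc.isBounded)
  obtain ⟨n, hn⟩ := exists_nat_gt (D / (δ / 2))
  have hD0 : 0 ≤ D := dist_nonneg.trans (hD hx₀ hx₀)
  have hn0 : (0 : ℝ) < n := lt_of_le_of_lt (by positivity) hn
  -- Times subdividing the segment from `x₀` to `s` into steps shorter than `δ / 2`; the cutoff at
  -- `1` keeps every `p k s` in `K`, for all `k`.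
  let w : ℕ → ℝ := fun k ↦ min (k / n) 1
  have hw0 : ∀ k, 0 ≤ w k := fun k ↦ le_min (by positivity) zero_le_one
  have hw1 : ∀ k, w k ≤ 1 := fun k ↦ min_le_right _ _
  have hwn : w n = 1 := by simp [w, hn0.ne']
  have hw : ∀ k, |w (k + 1) - w k| ≤ 1 / n := by
    intro k
    refine (abs_min_sub_min_le_max _ _ _ _).trans ?_
    rw [sub_self, abs_zero, Nat.cast_succ, ← sub_div, add_sub_cancel_left,
      abs_of_nonneg (by positivity)]
    exact max_le le_rfl (by positivity)
  let p : ℕ → K → K := fun k s ↦ ⟨AffineMap.lineMap x₀ (s : W) (w k),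
    hK.lineMap_mem hx₀ s.2 ⟨hw0 k, hw1 k⟩⟩
  have hp1 : ∀ k s t, dist (p k s) (p k t) ≤ dist s t := by
    intro k s t
    change dist (AffineMap.lineMap x₀ (s : W) (w k)) (AffineMap.lineMap x₀ (t : W) (w k)) ≤ _
    rw [dist_eq_norm, AffineMap.lineMap_apply_module, AffineMap.lineMap_apply_module,
      add_sub_add_left_eq_sub, ← smul_sub, norm_smul, Real.norm_of_nonneg (hw0 k),
      Subtype.dist_eq, dist_eq_norm]
    exact mul_le_of_le_one_left (norm_nonneg _) (hw1 k)
  have hp2 : ∀ k s, dist (p (k + 1) s) (p k s) < δ / 2 := by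
    intro k s
    change dist (AffineMap.lineMap x₀ (s : W) (w (k + 1))) (AffineMap.lineMap x₀ (s : W) (w k)) < _
    rw [dist_lineMap_lineMap, Real.dist_eq]
    refine (mul_le_mul (hw k) (hD hx₀ s.2) dist_nonneg (by positivity)).trans_lt ?_
    rw [div_lt_iff₀ (by positivity)] at hn
    rw [one_div, inv_mul_lt_iff₀ hn0]
    exact hn
  have hpn : ∀ s, p n s = s := by
    intro s
    ext1
    change AffineMap.lineMap x₀ (s : W) (w n) = (s : W)
    rw [hwn, AffineMap.lineMap_apply_one]
  let S : ℕ → K → ℝ := fun m s ↦ ∑ k ∈ Finset.range m, (G (p k s) (p (k + 1) s) - G (p k s) (p k s))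
  -- `S` integrates along the radial segment. The segments to `s` and `t` bound a strip of small
  -- quadrilaterals; around each the increments of one local primitive cancel, so only the last
  -- edge, from `p m s` to `p m t`, remains.
  have hS : ∀ s t, dist t s < δ / 2 → ∀ m, S m t - S m s = G (p m s) (p m t) - G (p m s) (p m s) := by
    intro s t hst m
    have hself : ∀ a : K, dist a a < δ := fun a ↦ by rw [dist_self]; exact hδ
    have hts : ∀ k, dist (p k t) (p k s) < δ / 2 := fun k ↦ (hp1 k t s).trans_lt hst
    have hnext : ∀ k s, dist (p (k + 1) s) (p k s) < δ := fun k s ↦ by linarith [hp2 k s]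
    induction m with
    | zero =>
      have : p 0 t = p 0 s := by
        ext1
        simp [p, w]
      simp [S, this]
    | succ m ih =>
      have e1 : S (m + 1) t = S m t + (G (p m t) (p (m + 1) t) - G (p m t) (p m t)) :=
        Finset.sum_range_succ _ _
      have e2 : S (m + 1) s = S m s + (G (p m s) (p (m + 1) s) - G (p m s) (p m s)) :=
        Finset.sum_range_succ _ _
      have hd1 : dist (p (m + 1) t) (p m s) < δ := by
        linarith [dist_triangle (p (m + 1) t) (p m t) (p m s), hp2 m t, hts m]
      have e3 := hG (p m t) (p m s) (p (m + 1) t) (p m t) (hnext m t) hd1 (hself _)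
        (by linarith [hts m])
      have e4 := hG (p m s) (p (m + 1) s) (p (m + 1) t) (p (m + 1) s) hd1
        (by linarith [hts (m + 1)]) (hnext m s) (hself _)
      linarith
  refine ⟨S n, fun s ↦ ⟨U (i s), (hUo _).mem_nhds (hi s s (by rw [dist_self]; exact hδ)), f (i s),
    hf _, ?_⟩⟩
  filter_upwards [Metric.ball_mem_nhds s (half_pos hδ)] with t ht
  have := hS s t ht n
  rwa [hpn, hpn] at this

instance preconnectedSpace_stdSimplex (n : ℕ) : PreconnectedSpace (stdSimplex ℝ (Fin n)) :=
  Subtype.preconnectedSpace (convex_stdSimplex ℝ (Fin n)).isPreconnected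

lemma IsPrimitiveOver.integralOver_eq {σ : Simplex1 M} {F : stdSimplex ℝ (Fin 2) → ℝ}
    (hF : IsPrimitiveOver η σ F) :
    integralOver η σ = F (stdSimplex.vertex 1) - F (stdSimplex.vertex 0) := by
  have hex : ∃ F, IsPrimitiveAlong η σ F := ⟨F, hF⟩
  rw [integralOver, dif_pos hex]
  exact IsPrimitiveOver.sub_eq_sub hex.choose_spec hF σ.continuous _ _

/-- Stokes' theorem on singular 2-simplices. -/
lemma IsClosedForm.integralOver_boundary (hη : IsClosedForm η) (τ : C(stdSimplex ℝ (Fin 3), M)) :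
    integralOver η (face 0 τ) - integralOver η (face 1 τ) + integralOver η (face 2 τ) = 0 := by
  obtain ⟨F, hF⟩ := hη.exists_isPrimitiveOver (convex_stdSimplex ℝ (Fin 3))
    (isCompact_stdSimplex ℝ (Fin 3)) τ
  -- A primitive along all of `τ` restricts to each face, so every edge integral is a difference of
  -- vertex values and the alternating sum cancels.
  have h : ∀ i : Fin 3, integralOver η (face i τ) =
      F (stdSimplex.vertex (i.succAbove 1)) - F (stdSimplex.vertex (i.succAbove 0)) := by
    intro i
    have h1 : IsPrimitiveOver η (face i τ) (F ∘ stdSimplex.map i.succAbove) :=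
      hF.comp (stdSimplex.continuous_map _)
    rw [h1.integralOver_eq]
    simp [stdSimplex.map_vertex]
  rw [h, h, h]
  have e1 : (0 : Fin 3).succAbove 1 = 2 := rfl
  have e2 : (0 : Fin 3).succAbove 0 = 1 := rfl
  have e3 : (1 : Fin 3).succAbove 1 = 2 := rfl
  have e4 : (1 : Fin 3).succAbove 0 = 0 := rfl
  have e5 : (2 : Fin 3).succAbove 1 = 1 := rfl
  have e6 : (2 : Fin 3).succAbove 0 = 0 := rfl
  rw [e1, e2, e3, e4, e5, e6]
  ring

lemma IsClosedForm.pairing_eq (hη : IsClosedForm η) {c c' : Simplex1 M →₀ ℝ} {h : H1 M}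
    (hc : Represents c h) (hc' : Represents c' h) :
    (c.sum fun σ r ↦ r * integralOver η σ) = c'.sum fun σ r ↦ r * integralOver η σ :=
  hc.sum_eq_of_cocycle hc' _ hη.integralOver_boundary

end Primitives

/-! ### The tangent bundle -/

section TangentBundle

variable {E : Type u} [NormedAddCommGroup E] [NormedSpace ℝ E]
  {M : Type v} [TopologicalSpace M] [ChartedSpace E M] [IsManifold 𝓘(ℝ, E) ∞ M]

instance t2Space_tangentBundle [T2Space M] : T2Space (TangentBundle 𝓘(ℝ, E) M) := by
  refine ⟨fun p q hpq ↦ ?_⟩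
  by_cases h : p.1 = q.1
  · let e := trivializationAt E (TangentSpace 𝓘(ℝ, E) : M → Type u) p.1
    have hp : p ∈ e.source := FiberBundle.mem_trivializationAt_proj_source
    have hq : q ∈ e.source := by
      rw [e.mem_source, ← h]
      exact FiberBundle.mem_baseSet_trivializationAt' p.1
    have hne : e p ≠ e q := fun h ↦ hpq (e.toOpenPartialHomeomorph.injOn hp hq h)
    obtain ⟨u, v, hu, hv, hpu, hqv, huv⟩ := t2_separation hne
    exact ⟨_, _, e.toOpenPartialHomeomorph.isOpen_inter_preimage hu,
      e.toOpenPartialHomeomorph.isOpen_inter_preimage hv, ⟨hp, hpu⟩, ⟨hq, hqv⟩,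
      (huv.preimage _).mono inter_subset_right inter_subset_right⟩
  · exact separated_by_continuous (FiberBundle.continuous_proj E _) h

lemma continuous_vnorm (g : Metric E M) : Continuous (vnorm g) := by
  let : RiemannianBundle (fun x : M ↦ TangentSpace 𝓘(ℝ, E) x) := ⟨g.toRiemannianMetric⟩
  have : IsContinuousRiemannianBundle E (fun x : M ↦ TangentSpace 𝓘(ℝ, E) x) :=
    ⟨g.inner, g.contMDiff.continuous, fun _ _ _ ↦ rfl⟩
  have h : Continuous fun p : TangentBundle 𝓘(ℝ, E) M ↦ (⟨p.1, p.2⟩ : TangentBundle 𝓘(ℝ, E) M) :=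
    continuous_id
  exact (Continuous.inner_bundle (F := E) (E := fun x : M ↦ TangentSpace 𝓘(ℝ, E) x) h h).sqrt

lemma vnorm_nonneg (g : Metric E M) (p : TangentBundle 𝓘(ℝ, E) M) : 0 ≤ vnorm g p :=
  Real.sqrt_nonneg _

lemma vnorm_smul (g : Metric E M) (x : M) (r : ℝ) (v : TangentSpace 𝓘(ℝ, E) x) :
    vnorm g ⟨x, r • v⟩ = |r| * vnorm g ⟨x, v⟩ := by
  simp only [vnorm, map_smul, smul_apply, smul_eq_mul]
  rw [← mul_assoc, Real.sqrt_mul (mul_self_nonneg r), Real.sqrt_mul_self_eq_abs]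

lemma eq_zero_of_vnorm_eq_zero (g : Metric E M) {x : M} {v : TangentSpace 𝓘(ℝ, E) x}
    (h : vnorm g ⟨x, v⟩ = 0) : v = 0 := by
  by_contra hv
  exact (Real.sqrt_pos.2 (g.pos x v hv)).ne' h

/-- The direction of the local norm comparison that keeps the disc bundle bounded in a
trivialization. -/
lemma exists_norm_trivializationAt_le (g : Metric E M) (x₀ : M) :
    ∃ C > 0, ∀ᶠ x in 𝓝 x₀, ∀ v : TangentSpace 𝓘(ℝ, E) x,
      ‖(trivializationAt E (TangentSpace 𝓘(ℝ, E) : M → Type u) x₀ ⟨x, v⟩).2‖ ≤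
        C * vnorm g ⟨x, v⟩ := by
  let : RiemannianBundle (fun x : M ↦ TangentSpace 𝓘(ℝ, E) x) := ⟨g.toRiemannianMetric⟩
  have : IsContinuousRiemannianBundle E (fun x : M ↦ TangentSpace 𝓘(ℝ, E) x) :=
    ⟨g.inner, g.contMDiff.continuous, fun _ _ _ ↦ rfl⟩
  obtain ⟨C, hC, h⟩ := eventually_norm_trivializationAt_lt E
    (fun x : M ↦ TangentSpace 𝓘(ℝ, E) x) x₀
  refine ⟨C, hC, ?_⟩
  filter_upwards [h, (trivializationAt E (TangentSpace 𝓘(ℝ, E) : M → Type u)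
    x₀).open_baseSet.mem_nhds (FiberBundle.mem_baseSet_trivializationAt' x₀)] with x hx hx' v
  have h1 := ((trivializationAt E (fun x : M ↦ TangentSpace 𝓘(ℝ, E) x)
    x₀).continuousLinearMapAt ℝ x).le_of_opNorm_le hx.le v
  rw [Trivialization.continuousLinearMapAt_apply,
    Trivialization.coe_linearMapAt_of_mem _ hx'] at h1
  exact h1

/-- Over a small compact `K` the disc bundle lies in the image of `K` times a ball under a
trivialization; finitely many such `K` cover `M`. -/
lemma isCompact_setOf_vnorm_le [FiniteDimensional ℝ E] [T2Space M] [CompactSpace M]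
    (g : Metric E M) (R : ℝ) : IsCompact {p | vnorm g p ≤ R} := by
  have : ProperSpace E := FiniteDimensional.proper ℝ E
  have : LocallyCompactSpace M := ChartedSpace.locallyCompactSpace E M
  have hloc : ∀ x₀ : M, ∃ K ∈ 𝓝 x₀, ∃ Q : Set (TangentBundle 𝓘(ℝ, E) M), IsCompact Q ∧
      ∀ p : TangentBundle 𝓘(ℝ, E) M, p.1 ∈ K → vnorm g p ≤ R → p ∈ Q := by
    intro x₀
    let e := trivializationAt E (TangentSpace 𝓘(ℝ, E) : M → Type u) x₀
    obtain ⟨C, hC, h⟩ := exists_norm_trivializationAt_le g x₀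
    obtain ⟨K, hK, hKs, hKc⟩ := local_compact_nhds (h.and (show ∀ᶠ x in 𝓝 x₀, x ∈ e.baseSet from
      e.open_baseSet.mem_nhds (FiberBundle.mem_baseSet_trivializationAt' x₀)))
    refine ⟨K, hK, e.toOpenPartialHomeomorph.symm '' (K ×ˢ Metric.closedBall 0 (C * R)),
      (hKc.prod (isCompact_closedBall _ _)).image_of_continuousOn
        (e.toOpenPartialHomeomorph.continuousOn_symm.mono ?_), fun p hp hpR ↦ ?_⟩
    · rintro ⟨x, w⟩ ⟨hx, -⟩
      exact e.mem_target.2 (hKs hx).2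
    · have hps : p ∈ e.source := e.mem_source.2 (hKs hp).2
      refine ⟨e p, ⟨?_, ?_⟩, e.toOpenPartialHomeomorph.left_inv hps⟩
      · rw [e.coe_fst hps]
        exact hp
      · rw [mem_closedBall_zero_iff]
        exact ((hKs hp).1 p.2).trans (mul_le_mul_of_nonneg_left hpR hC.le)
  choose K hK Q hQ hKQ using hloc
  obtain ⟨t, ht⟩ := isCompact_univ.elim_nhds_subcover K fun x _ ↦ hK x
  refine (t.isCompact_biUnion fun x _ ↦ hQ x).of_isClosed_subset
    (isClosed_le (continuous_vnorm g) continuous_const) fun p hp ↦ ?_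
  obtain ⟨x, hx, hpx⟩ := mem_iUnion₂.1 (ht.2 (mem_univ p.1))
  exact mem_iUnion₂.2 ⟨x, hx, hKQ x p hpx hp⟩

/-- A continuous 1-form. -/
def IsContinuousForm (θ : ∀ x : M, TangentSpace 𝓘(ℝ, E) x →L[ℝ] ℝ) : Prop :=
  ∀ x₀ : M, ContinuousOn (coeffInChart θ x₀) (chartAt E x₀).target

omit [IsManifold 𝓘(ℝ, E) ∞ M] in
lemma IsClosedForm.isContinuousForm {η : ∀ x : M, TangentSpace 𝓘(ℝ, E) x →L[ℝ] ℝ}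
    (hη : IsClosedForm η) : IsContinuousForm η :=
  fun x₀ ↦ (hη.smooth x₀).continuousOn

/-- The trivialization of the tangent bundle is the derivative of the chart, and the coefficients
contain the derivative of its inverse; the two cancel. -/
lemma form_eq_coeffInChart (θ : ∀ x : M, TangentSpace 𝓘(ℝ, E) x →L[ℝ] ℝ) (x₀ : M)
    {p : TangentBundle 𝓘(ℝ, E) M} (hp : p.1 ∈ (chartAt E x₀).source) :
    θ p.1 p.2 = coeffInChart θ x₀ (chartAt E x₀ p.1)
      (trivializationAt E (TangentSpace 𝓘(ℝ, E) : M → Type u) x₀ p).2 := by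
  have : IsManifold 𝓘(ℝ, E) 1 M := IsManifold.of_le (n := ∞) (by simp)
  have hm := mdifferentiable_chart (I := 𝓘(ℝ, E)) x₀
  have h1 := congrArg (fun A ↦ A p.2) (hm.symm_comp_deriv hp)
  have h2 : (trivializationAt E (TangentSpace 𝓘(ℝ, E) : M → Type u) x₀ p).2 =
      mfderiv 𝓘(ℝ, E) 𝓘(ℝ, E) (chartAt E x₀) p.1 p.2 := by
    have h3 := TangentBundle.continuousLinearMapAt_trivializationAt (I := 𝓘(ℝ, E)) hp
    have h4 := congrArg (fun A ↦ A p.2) h3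
    rw [Trivialization.continuousLinearMapAt_apply,
      Trivialization.coe_linearMapAt_of_mem _ (by simpa using hp)] at h4
    exact h4
  rw [h2]
  have h3 : ∀ z, z = p.1 → ∀ w : E, θ z w = θ p.1 w := by
    rintro z rfl w
    rfl
  exact ((h3 _ ((chartAt E x₀).left_inv hp) _).trans (congrArg (θ p.1) h1)).symm

lemma IsContinuousForm.continuous {θ : ∀ x : M, TangentSpace 𝓘(ℝ, E) x →L[ℝ] ℝ}
    (hθ : IsContinuousForm θ) :
    Continuous fun p : TangentBundle 𝓘(ℝ, E) M ↦ (θ p.1 p.2 : ℝ) := by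
  rw [continuous_iff_continuousAt]
  intro p
  have hπ : Continuous fun p : TangentBundle 𝓘(ℝ, E) M ↦ p.1 := FiberBundle.continuous_proj E _
  have hs := mem_chart_source E p.1
  have hev : (fun q : TangentBundle 𝓘(ℝ, E) M ↦ (θ q.1 q.2 : ℝ)) =ᶠ[𝓝 p] fun q ↦
      coeffInChart θ p.1 (chartAt E p.1 q.1)
        (trivializationAt E (TangentSpace 𝓘(ℝ, E) : M → Type u) p.1 q).2 := by
    filter_upwards [hπ.continuousAt.eventually ((chartAt E p.1).open_source.mem_nhds hs)] with q hq
    exact form_eq_coeffInChart θ p.1 hq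
  refine ContinuousAt.congr ?_ hev.symm
  refine ContinuousAt.clm_apply ?_ ?_
  · have h1 : ContinuousAt (coeffInChart θ p.1) (chartAt E p.1 p.1) :=
      (hθ p.1).continuousAt ((chartAt E p.1).open_target.mem_nhds (mem_chart_target E p.1))
    exact ContinuousAt.comp (f := fun q : TangentBundle 𝓘(ℝ, E) M ↦ chartAt E p.1 q.1) h1
      (((chartAt E p.1).continuousAt hs).comp
        (f := fun q : TangentBundle 𝓘(ℝ, E) M ↦ q.1) hπ.continuousAt)
  · exact continuous_snd.continuousAt.comp ((trivializationAt E (TangentSpace 𝓘(ℝ, E) :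
      M → Type u) p.1).continuousAt FiberBundle.mem_trivializationAt_proj_source)

/-- Compactness of the unit disc bundle and homogeneity in the fibre. This is the linear growth that
the constraints need in `exists_isLeast_integral`. -/
lemma IsContinuousForm.exists_abs_le [FiniteDimensional ℝ E] [T2Space M] [CompactSpace M]
    {θ : ∀ x : M, TangentSpace 𝓘(ℝ, E) x →L[ℝ] ℝ} (hθ : IsContinuousForm θ) (g : Metric E M) :
    ∃ C, ∀ p : TangentBundle 𝓘(ℝ, E) M, |θ p.1 p.2| ≤ C * vnorm g p := by
  obtain ⟨C, hC⟩ := ((isCompact_setOf_vnorm_le g 1).image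
    (continuous_abs.comp hθ.continuous)).bddAbove
  refine ⟨C, fun ⟨x, v⟩ ↦ ?_⟩
  rcases eq_or_ne (vnorm g ⟨x, v⟩) 0 with h | h
  · have := eq_zero_of_vnorm_eq_zero g h
    subst this
    rw [h]
    simp
  · have hpos : 0 < vnorm g ⟨x, v⟩ := lt_of_le_of_ne (vnorm_nonneg g _) h.symm
    have h1 : |θ x ((vnorm g ⟨x, v⟩)⁻¹ • v)| ≤ C := by
      refine hC ⟨⟨x, (vnorm g ⟨x, v⟩)⁻¹ • v⟩, ?_, rfl⟩
      change vnorm g ⟨x, _⟩ ≤ 1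
      rw [vnorm_smul, abs_of_pos (inv_pos.2 hpos), inv_mul_cancel₀ h]
    rw [map_smul, smul_eq_mul, abs_mul, abs_of_pos (inv_pos.2 hpos),
      inv_mul_le_iff₀ hpos] at h1
    change |θ x v| ≤ _
    linarith

/-- The differential of a function, as a 1-form. -/
def differential (f : M → ℝ) (x : M) : TangentSpace 𝓘(ℝ, E) x →L[ℝ] ℝ :=
  mfderiv 𝓘(ℝ, E) 𝓘(ℝ, ℝ) f x

omit [IsManifold 𝓘(ℝ, E) ∞ M] in
lemma hasMFDerivAt_differential {f : M → ℝ} (hf : ContMDiff 𝓘(ℝ, E) 𝓘(ℝ, ℝ) 1 f) (x : M) :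
    HasMFDerivAt 𝓘(ℝ, E) 𝓘(ℝ, ℝ) f x (differential f x) :=
  (hf.mdifferentiable (by simp) x).hasMFDerivAt

lemma isContinuousForm_differential {f : M → ℝ} (hf : ContMDiff 𝓘(ℝ, E) 𝓘(ℝ, ℝ) 1 f) :
    IsContinuousForm (differential (E := E) f) := by
  intro x₀
  have : IsManifold 𝓘(ℝ, E) 1 M := IsManifold.of_le (n := ∞) (by simp)
  have h1 : ContDiffOn ℝ 1 (f ∘ (chartAt E x₀).symm) (chartAt E x₀).target :=
    (hf.comp_contMDiffOn (contMDiffOn_chart_symm (I := 𝓘(ℝ, E)))).contDiffOn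
  refine (h1.continuousOn_fderiv_of_isOpen (chartAt E x₀).open_target le_rfl).congr fun y hy ↦ ?_
  exact (hasFDerivAt_comp_chartAt_symm x₀ hy (hasMFDerivAt_differential hf _)).fderiv.symm

end TangentBundle

/-! ### Closed measures with prescribed rotation vector -/

section Realization

/-- A finite measure concentrated on a compact set. -/
structure IsCompactlyConcentrated {X : Type*} [TopologicalSpace X] [MeasurableSpace X]
    (ν : Measure X) : Prop where
  finite : IsFiniteMeasure ν
  compact : ∃ Q, IsCompact Q ∧ ν Qᶜ = 0

lemma IsCompactlyConcentrated.integrable {X : Type*} [TopologicalSpace X] [MeasurableSpace X]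
    [BorelSpace X] {ν : Measure X} (hν : IsCompactlyConcentrated ν) {f : X → ℝ}
    (hf : Continuous f) : Integrable f ν := by
  obtain ⟨Q, hQ, hQ0⟩ := hν.compact
  have := hν.finite
  obtain ⟨C, hC⟩ := hQ.exists_bound_of_continuousOn hf.continuousOn
  refine .of_bound hf.measurable.aestronglyMeasurable C ?_
  filter_upwards [measure_eq_zero_iff_ae_notMem.1 hQ0] with x hx
  exact hC x (not_not.1 hx)

lemma IsCompactlyConcentrated.add {X : Type*} [TopologicalSpace X] [MeasurableSpace X]
    {ν ν' : Measure X} (hν : IsCompactlyConcentrated ν) (hν' : IsCompactlyConcentrated ν') :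
    IsCompactlyConcentrated (ν + ν') := by
  have := hν.finite
  have := hν'.finite
  obtain ⟨Q, hQ, hQ0⟩ := hν.compact
  obtain ⟨Q', hQ', hQ0'⟩ := hν'.compact
  refine ⟨inferInstance, Q ∪ Q', hQ.union hQ', ?_⟩
  rw [Measure.add_apply, measure_mono_null (compl_subset_compl.2 subset_union_left) hQ0,
    measure_mono_null (compl_subset_compl.2 subset_union_right) hQ0', add_zero]

variable {E : Type u} [NormedAddCommGroup E] [NormedSpace ℝ E]
  {M : Type v} [TopologicalSpace M] [ChartedSpace E M] [IsManifold 𝓘(ℝ, E) ∞ M]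

/-- The straight segment from `a` to `b` in the chart at `x₀`, with its velocity multiplied
by `k`. -/
def chartSegment (x₀ : M) (a b : E) (k : ℝ) (u : ℝ) : TangentBundle 𝓘(ℝ, E) M :=
  (trivializationAt E (TangentSpace 𝓘(ℝ, E) : M → Type u) x₀).toOpenPartialHomeomorph.symm
    ((chartAt E x₀).symm (a + u • (b - a)), k • (b - a))

variable {x₀ : M} {a b : E}

lemma continuousOn_chartSegment (k : ℝ)
    (h : ∀ u ∈ Icc (0 : ℝ) 1, a + u • (b - a) ∈ (chartAt E x₀).target) :
    ContinuousOn (chartSegment x₀ a b k) (Icc 0 1) := by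
  let e := trivializationAt E (TangentSpace 𝓘(ℝ, E) : M → Type u) x₀
  have h1 : ContinuousOn (fun u : ℝ ↦ ((chartAt E x₀).symm (a + u • (b - a)), k • (b - a)))
      (Icc 0 1) := by
    refine ContinuousOn.prodMk ?_ continuousOn_const
    exact (chartAt E x₀).continuousOn_symm.comp (by fun_prop) h
  refine e.toOpenPartialHomeomorph.continuousOn_symm.comp h1 fun u hu ↦ ?_
  exact e.mem_target.2 (by simpa [e] using (chartAt E x₀).map_target (h u hu))

lemma form_chartSegment (θ : ∀ x : M, TangentSpace 𝓘(ℝ, E) x →L[ℝ] ℝ) (k : ℝ) {u : ℝ}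
    (h : a + u • (b - a) ∈ (chartAt E x₀).target) :
    θ (chartSegment x₀ a b k u).1 (chartSegment x₀ a b k u).2 =
      k * coeffInChart θ x₀ (a + u • (b - a)) (b - a) := by
  let e := trivializationAt E (TangentSpace 𝓘(ℝ, E) : M → Type u) x₀
  have ht : ((chartAt E x₀).symm (a + u • (b - a)), k • (b - a)) ∈ e.target :=
    e.mem_target.2 (by simpa [e] using (chartAt E x₀).map_target h)
  have h1 : e (chartSegment x₀ a b k u) = ((chartAt E x₀).symm (a + u • (b - a)), k • (b - a)) :=
    e.toOpenPartialHomeomorph.right_inv ht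
  have hs : chartSegment x₀ a b k u ∈ e.source := e.toOpenPartialHomeomorph.map_target ht
  have h2 : (chartSegment x₀ a b k u).1 = (chartAt E x₀).symm (a + u • (b - a)) := by
    have := e.coe_fst hs
    rw [h1] at this
    exact this.symm
  rw [form_eq_coeffInChart θ x₀ (by rw [h2]; exact (chartAt E x₀).map_target h)]
  change coeffInChart θ x₀ _ (e (chartSegment x₀ a b k u)).2 = _
  rw [h1, h2, (chartAt E x₀).right_inv h, map_smul, smul_eq_mul]

/-- The measure of mass `w` on a chart segment, such that integrating the differential of `f` gives
`r` times the increment of `f`. -/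
def segmentMeasure (x₀ : M) (a b : E) (r w : ℝ) : Measure (TangentBundle 𝓘(ℝ, E) M) :=
  ENNReal.ofReal w • (volume.restrict (Icc (0 : ℝ) 1)).map (chartSegment x₀ a b (r / w))

lemma aemeasurable_chartSegment (k : ℝ)
    (h : ∀ u ∈ Icc (0 : ℝ) 1, a + u • (b - a) ∈ (chartAt E x₀).target) :
    AEMeasurable (chartSegment x₀ a b k) (volume.restrict (Icc (0 : ℝ) 1)) :=
  (continuousOn_chartSegment k h).aemeasurable measurableSet_Icc

lemma segmentMeasure_univ (r w : ℝ)
    (h : ∀ u ∈ Icc (0 : ℝ) 1, a + u • (b - a) ∈ (chartAt E x₀).target) :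
    segmentMeasure x₀ a b r w univ = ENNReal.ofReal w := by
  rw [segmentMeasure, Measure.smul_apply, Measure.map_apply_of_aemeasurable
    (aemeasurable_chartSegment _ h) MeasurableSet.univ]
  simp

lemma isCompactlyConcentrated_segmentMeasure [T2Space M] (r w : ℝ)
    (h : ∀ u ∈ Icc (0 : ℝ) 1, a + u • (b - a) ∈ (chartAt E x₀).target) :
    IsCompactlyConcentrated (segmentMeasure x₀ a b r w) := by
  refine ⟨⟨?_⟩, chartSegment x₀ a b (r / w) '' Icc 0 1,
    isCompact_Icc.image_of_continuousOn (continuousOn_chartSegment _ h), ?_⟩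
  · rw [segmentMeasure_univ r w h]
    exact ENNReal.ofReal_lt_top
  · have hm : MeasurableSet (chartSegment x₀ a b (r / w) '' Icc 0 1)ᶜ :=
      (isCompact_Icc.image_of_continuousOn (continuousOn_chartSegment _ h)).measurableSet.compl
    rw [segmentMeasure, Measure.smul_apply,
      Measure.map_apply_of_aemeasurable (aemeasurable_chartSegment _ h) hm,
      Measure.restrict_apply' measurableSet_Icc]
    have : chartSegment x₀ a b (r / w) ⁻¹' (chartSegment x₀ a b (r / w) '' Icc 0 1)ᶜ ∩
        Icc (0 : ℝ) 1 = ∅ := by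
      ext u
      simp only [mem_inter_iff, mem_preimage, mem_compl_iff, mem_empty_iff_false, iff_false, not_and]
      exact fun h1 h2 ↦ h1 ⟨u, h2, rfl⟩
    rw [this, measure_empty, smul_zero]

/-- Forms are linear in the velocity, so the factor `r / w` in the speed and the mass `w` combine to
`r`: the mass can be chosen freely. The rest is the fundamental theorem of calculus. -/
lemma integral_segmentMeasure (r : ℝ) {w : ℝ} (hw : 0 < w)
    (h : ∀ u ∈ Icc (0 : ℝ) 1, a + u • (b - a) ∈ (chartAt E x₀).target)
    {θ : ∀ x : M, TangentSpace 𝓘(ℝ, E) x →L[ℝ] ℝ} (hθ : IsContinuousForm θ) {f : M → ℝ}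
    (hf : ∀ u ∈ Icc (0 : ℝ) 1, HasMFDerivAt 𝓘(ℝ, E) 𝓘(ℝ, ℝ) f
      ((chartAt E x₀).symm (a + u • (b - a))) (θ ((chartAt E x₀).symm (a + u • (b - a))))) :
    ∫ p, θ p.1 p.2 ∂(segmentMeasure x₀ a b r w) =
      r * (f ((chartAt E x₀).symm b) - f ((chartAt E x₀).symm a)) := by
  rw [segmentMeasure, integral_smul_measure, integral_map (aemeasurable_chartSegment _ h)
    hθ.continuous.measurable.aestronglyMeasurable, ENNReal.toReal_ofReal hw.le]
  have h1 : ∫ u in Icc (0 : ℝ) 1, θ (chartSegment x₀ a b (r / w) u).1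
      (chartSegment x₀ a b (r / w) u).2 =
      ∫ u in (0 : ℝ)..1, (r / w) * coeffInChart θ x₀ (a + u • (b - a)) (b - a) := by
    rw [intervalIntegral.integral_of_le zero_le_one, ← integral_Icc_eq_integral_Ioc]
    exact setIntegral_congr_fun measurableSet_Icc fun u hu ↦ form_chartSegment θ _ (h u hu)
  have hcont : ContinuousOn (fun u : ℝ ↦ coeffInChart θ x₀ (a + u • (b - a)) (b - a))
      (Icc 0 1) :=
    ((hθ x₀).comp (by fun_prop) h).clm_apply continuousOn_const
  have h2 : ∫ u in (0 : ℝ)..1, coeffInChart θ x₀ (a + u • (b - a)) (b - a) =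
      f ((chartAt E x₀).symm (a + (1 : ℝ) • (b - a))) -
        f ((chartAt E x₀).symm (a + (0 : ℝ) • (b - a))) := by
    refine intervalIntegral.integral_eq_sub_of_hasDerivAt
      (f := fun u : ℝ ↦ f ((chartAt E x₀).symm (a + u • (b - a)))) (fun u hu ↦ ?_) ?_
    · rw [uIcc_of_le zero_le_one] at hu
      have h3 := hasFDerivAt_comp_chartAt_symm x₀ (h u hu) (hf u hu)
      have h4 : HasDerivAt (fun u : ℝ ↦ a + u • (b - a)) (b - a) u := by
        simpa using ((hasDerivAt_id u).smul_const (b - a)).const_add a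
      exact h3.comp_hasDerivAt u h4
    · refine ContinuousOn.intervalIntegrable ?_
      rwa [uIcc_of_le zero_le_one]
  rw [h1, intervalIntegral.integral_const_mul, h2]
  simp only [one_smul, zero_smul, add_zero, add_sub_cancel, smul_eq_mul]
  field_simp

/-- The measure `ν` of mass `w` integrates closed forms and differentials as `r` times the
piece of `σ` between the parameters `s` and `t` does. -/
structure RealizesPath (σ : Simplex1 M) (s t : stdSimplex ℝ (Fin 2)) (r w : ℝ)
    (ν : Measure (TangentBundle 𝓘(ℝ, E) M)) : Prop where
  conc : IsCompactlyConcentrated ν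
  mass : ν univ = ENNReal.ofReal w
  exact : ∀ f : M → ℝ, ContMDiff 𝓘(ℝ, E) 𝓘(ℝ, ℝ) 1 f →
    ∫ p, differential f p.1 p.2 ∂ν = r * (f (σ t) - f (σ s))
  closed : ∀ η : ∀ x : M, TangentSpace 𝓘(ℝ, E) x →L[ℝ] ℝ, IsClosedForm η → ∀ F,
    IsPrimitiveOver η σ F → ∫ p, η p.1 p.2 ∂ν = r * (F t - F s)

lemma eventually_exists_realizesPath [T2Space M] (σ : Simplex1 M) (s : stdSimplex ℝ (Fin 2)) :
    ∀ᶠ t in 𝓝 s, ∀ r w : ℝ, 0 < w → ∃ ν, RealizesPath (E := E) σ s t r w ν := by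
  obtain ⟨ρ, hρ, hball⟩ := exists_ball_subset_target E (σ s)
  have hnhds : σ ⁻¹' chartBall E (σ s) ρ ∈ 𝓝 s :=
    σ.continuous.continuousAt.preimage_mem_nhds (chartBall_mem_nhds (E := E) (σ s) hρ)
  obtain ⟨ε, hε, hA⟩ := Metric.mem_nhds_iff.1 hnhds
  filter_upwards [Metric.ball_mem_nhds s hε] with t ht r w hw
  have hpre : IsPreconnected (Metric.ball s ε) :=
    isPreconnected_preimage_val (convex_stdSimplex ℝ (Fin 2)) (convex_ball s.1 ε)
  let φ := chartAt E (σ s)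
  have hs' := hA (Metric.mem_ball_self hε)
  have ht' := hA ht
  have hseg : ∀ u ∈ Icc (0 : ℝ) 1, φ (σ s) + u • (φ (σ t) - φ (σ s)) ∈
      Metric.ball (φ (σ s)) ρ := fun u hu ↦
    (convex_ball _ _).add_smul_sub_mem hs'.2 ht'.2 hu
  have hseg' := fun u hu ↦ hball (hseg u hu)
  have hU : ∀ x ∈ chartBall E (σ s) ρ, chartBall E (σ s) ρ ∈ 𝓝 x := fun x hx ↦
    ((chartAt E (σ s)).isOpen_inter_preimage Metric.isOpen_ball).mem_nhds hx
  have hmem : ∀ u ∈ Icc (0 : ℝ) 1, φ.symm (φ (σ s) + u • (φ (σ t) - φ (σ s))) ∈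
      chartBall E (σ s) ρ := fun u hu ↦
    ⟨φ.map_target (hseg' u hu), by rw [mem_preimage, φ.right_inv (hseg' u hu)]; exact hseg u hu⟩
  refine ⟨segmentMeasure (σ s) (φ (σ s)) (φ (σ t)) r w,
    isCompactlyConcentrated_segmentMeasure r w hseg', segmentMeasure_univ r w hseg',
    fun f hf ↦ ?_, fun η hη F hF ↦ ?_⟩
  · rw [integral_segmentMeasure r hw hseg' (isContinuousForm_differential hf)
      fun u _ ↦ hasMFDerivAt_differential hf _, φ.left_inv hs'.1, φ.left_inv ht'.1]
  · obtain ⟨f, hf⟩ := hη.exists_primitive (σ s) hball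
    rw [integral_segmentMeasure r hw hseg' hη.isContinuousForm fun u hu ↦ hf _ (hmem u hu),
      φ.left_inv hs'.1, φ.left_inv ht'.1]
    rw [hF.sub_eq_of_mapsTo σ.continuous hU hf hpre hA (Metric.mem_ball_self hε) ht]

/-- Short pieces are realized by a single chart segment, and connectedness of the simplex chains
them. Reversing a path is a change of sign of `r`; concatenation splits the mass into halves. -/
lemma exists_realizesPath [T2Space M] (σ : Simplex1 M) (s t : stdSimplex ℝ (Fin 2)) (r : ℝ)
    {w : ℝ} (hw : 0 < w) : ∃ ν, RealizesPath (E := E) σ s t r w ν := by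
  have hsymm : ∀ s t, (∀ r w : ℝ, 0 < w → ∃ ν, RealizesPath (E := E) σ s t r w ν) →
      ∀ r w : ℝ, 0 < w → ∃ ν, RealizesPath (E := E) σ t s r w ν := by
    intro s t h r w hw
    obtain ⟨ν, hν⟩ := h (-r) w hw
    refine ⟨ν, hν.conc, hν.mass, fun f hf ↦ ?_, fun η hη F hF ↦ ?_⟩
    · rw [hν.exact f hf]
      ring
    · rw [hν.closed η hη F hF]
      ring
  refine PreconnectedSpace.induction₂'
    (fun s t ↦ ∀ r w : ℝ, 0 < w → ∃ ν, RealizesPath (E := E) σ s t r w ν) (fun s ↦ ?_) ⟨?_⟩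
    s t r w hw
  · filter_upwards [eventually_exists_realizesPath (E := E) σ s] with t ht
    exact ⟨ht, hsymm s t ht⟩
  · intro s t q h1 h2 r w hw
    obtain ⟨ν, hν⟩ := h1 r (w / 2) (half_pos hw)
    obtain ⟨ν', hν'⟩ := h2 r (w / 2) (half_pos hw)
    refine ⟨ν + ν', hν.conc.add hν'.conc, ?_, fun f hf ↦ ?_, fun η hη F hF ↦ ?_⟩
    · rw [Measure.add_apply, hν.mass, hν'.mass,
        ← ENNReal.ofReal_add (half_pos hw).le (half_pos hw).le, add_halves]
    · have hc := (isContinuousForm_differential hf).continuous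
      rw [integral_add_measure (hν.conc.integrable hc) (hν'.conc.integrable hc), hν.exact f hf,
        hν'.exact f hf]
      ring
    · have hc := hη.isContinuousForm.continuous
      rw [integral_add_measure (hν.conc.integrable hc) (hν'.conc.integrable hc),
        hν.closed η hη F hF, hν'.closed η hη F hF]
      ring

lemma exists_measure_realizing_chain [T2Space M] [Nonempty M] (c : Simplex1 M → ℝ)
    (S : Finset (Simplex1 M)) {w : ℝ} (hw : 0 < w) :
    ∃ ν : Measure (TangentBundle 𝓘(ℝ, E) M), IsCompactlyConcentrated ν ∧
      ν univ = ENNReal.ofReal w ∧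
      (∀ f : M → ℝ, ContMDiff 𝓘(ℝ, E) 𝓘(ℝ, ℝ) 1 f → ∫ p, differential f p.1 p.2 ∂ν =
        ∑ σ ∈ S, c σ * (f (σ (stdSimplex.vertex 1)) - f (σ (stdSimplex.vertex 0)))) ∧
      ∀ η : ∀ x : M, TangentSpace 𝓘(ℝ, E) x →L[ℝ] ℝ, IsClosedForm η →
        ∫ p, η p.1 p.2 ∂ν = ∑ σ ∈ S, c σ * integralOver η σ := by
  classical
  induction S using Finset.induction_on generalizing w with
  | empty =>
    -- A Dirac mass at a zero vector supplies the prescribed mass and integrates every form to zero.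
    obtain ⟨x⟩ := ‹Nonempty M›
    let p₀ : TangentBundle 𝓘(ℝ, E) M := ⟨x, 0⟩
    have hint : ∀ θ : ∀ x : M, TangentSpace 𝓘(ℝ, E) x →L[ℝ] ℝ, IsContinuousForm θ →
        ∫ p, θ p.1 p.2 ∂(ENNReal.ofReal w • Measure.dirac p₀) = 0 := by
      intro θ hθ
      rw [integral_smul_measure, integral_dirac' _ _ hθ.continuous.stronglyMeasurable]
      change _ • θ x 0 = 0
      rw [map_zero, smul_zero]
    refine ⟨ENNReal.ofReal w • Measure.dirac p₀, ⟨⟨?_⟩, {p₀}, isCompact_singleton, ?_⟩, ?_,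
      fun f hf ↦ hint _ (isContinuousForm_differential hf), fun η hη ↦ hint _ hη.isContinuousForm⟩
    · simp
    · simp
    · simp
  | insert σ S hσ ih =>
    obtain ⟨ν, hν1, hν2, hν3, hν4⟩ := ih (half_pos hw)
    obtain ⟨ν', hν'⟩ := exists_realizesPath (E := E) σ (stdSimplex.vertex 0)
      (stdSimplex.vertex 1) (c σ) (half_pos hw)
    refine ⟨ν' + ν, hν'.conc.add hν1, ?_, fun f hf ↦ ?_, fun η hη ↦ ?_⟩
    · rw [Measure.add_apply, hν2, hν'.mass,
        ← ENNReal.ofReal_add (half_pos hw).le (half_pos hw).le, add_halves]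
    · have hc := (isContinuousForm_differential hf).continuous
      rw [integral_add_measure (hν'.conc.integrable hc) (hν1.integrable hc), hν3 f hf,
        hν'.exact f hf, Finset.sum_insert hσ]
    · have hc := hη.isContinuousForm.continuous
      obtain ⟨F, hF⟩ := hη.exists_isPrimitiveOver (convex_stdSimplex ℝ (Fin 2))
        (isCompact_stdSimplex ℝ (Fin 2)) σ
      rw [integral_add_measure (hν'.conc.integrable hc) (hν1.integrable hc), hν4 η hη,
        hν'.closed η hη F hF, Finset.sum_insert hσ, hF.integralOver_eq]

/-- Every homology class is the rotation vector of a closed measure concentrated on a compact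
set. -/
theorem exists_isClosedMeasure_hasRotationVector [T2Space M] [Nonempty M] (g : Metric E M)
    (h : H1 M) : ∃ μ : Measure (TangentBundle 𝓘(ℝ, E) M), IsClosedMeasure g μ ∧
      HasRotationVector μ h ∧ IsCompactlyConcentrated μ := by
  obtain ⟨c, hc⟩ := exists_represents h
  obtain ⟨μ, h1, h2, h3, h4⟩ :=
    exists_measure_realizing_chain (E := E) (⇑c) c.support one_pos
  refine ⟨μ, ⟨⟨by simpa using h2⟩, h1.integrable (continuous_vnorm g), fun f hf ↦ ?_⟩,
    ⟨c, hc, fun η hη ↦ h4 η hη⟩, h1⟩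
  exact (h3 f hf).trans (hc.sum_boundary f)

end Realization

/-! ### Mather measures -/

section Mather

variable {E : Type u} [NormedAddCommGroup E] [NormedSpace ℝ E] [FiniteDimensional ℝ E]
  {M : Type v} [TopologicalSpace M] [T2Space M] [CompactSpace M] [ChartedSpace E M]
  [IsManifold 𝓘(ℝ, E) ∞ M] {g : Metric E M} {L : TangentBundle 𝓘(ℝ, E) M → ℝ}

/-- Ensures that a measure is concentrated on its support. -/
lemma secondCountableTopology_tangentBundle (g : Metric E M) :
    SecondCountableTopology (TangentBundle 𝓘(ℝ, E) M) := by
  have : ProperSpace E := FiniteDimensional.proper ℝ E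
  have : SigmaCompactSpace (TangentBundle 𝓘(ℝ, E) M) := by
    refine ⟨fun n ↦ {p | vnorm g p ≤ n}, fun n ↦ isCompact_setOf_vnorm_le g n, ?_⟩
    refine eq_univ_of_forall fun p ↦ mem_iUnion.2 ?_
    obtain ⟨n, hn⟩ := exists_nat_ge (vnorm g p)
    exact ⟨n, hn⟩
  have : SecondCountableTopology (ModelProd E E) :=
    inferInstanceAs (SecondCountableTopology (E × E))
  exact ChartedSpace.secondCountable_of_sigmaCompact (ModelProd E E) _

omit [FiniteDimensional ℝ E] [T2Space M] [CompactSpace M] in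
lemma IsTonelli.exists_mul_le (hL : IsTonelli g L) (K : ℝ) :
    ∃ R, ∀ p, R ≤ vnorm g p → K * vnorm g p ≤ L p := by
  obtain ⟨R, hR, h⟩ := hL.superlinear K
  exact ⟨R, fun p hp ↦ (le_div_iff₀ (hR.trans_le hp)).1 (h p hp)⟩

omit [FiniteDimensional ℝ E] [T2Space M] in
lemma exists_mul_le_perturb (hL : ∀ K, ∃ R, ∀ p, R ≤ vnorm g p → K * vnorm g p ≤ L p)
    {V : M → ℝ} (hV : Continuous V) (K : ℝ) :
    ∃ R, ∀ p, R ≤ vnorm g p → K * vnorm g p ≤ perturb L V p := by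
  -- The extra unit of slope absorbs the lower bound of `V` once the norm exceeds `-B`.
  obtain ⟨R, hR⟩ := hL (K + 1)
  obtain ⟨B, hB⟩ := (isCompact_range hV).bddBelow
  refine ⟨max R (-B), fun p hp ↦ ?_⟩
  have h1 := hR p ((le_max_left _ _).trans hp)
  have h2 := (le_max_right R (-B)).trans hp
  have h3 : B ≤ V p.1 := hB ⟨p.1, rfl⟩
  change _ ≤ L p + V p.1
  linarith

omit [FiniteDimensional ℝ E] [T2Space M] [CompactSpace M] in
lemma continuous_comp_proj {V : M → ℝ} (hV : Continuous V) :
    Continuous fun p : TangentBundle 𝓘(ℝ, E) M ↦ V p.1 :=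
  hV.comp (FiberBundle.continuous_proj E _)

omit [FiniteDimensional ℝ E] [T2Space M] in
lemma integrable_comp_proj {V : M → ℝ} (hV : Continuous V)
    {μ : Measure (TangentBundle 𝓘(ℝ, E) M)} [IsFiniteMeasure μ] :
    Integrable (fun p : TangentBundle 𝓘(ℝ, E) M ↦ V p.1) μ := by
  obtain ⟨C, hC⟩ := isCompact_univ.exists_bound_of_continuousOn hV.continuousOn
  exact .of_bound (continuous_comp_proj hV).measurable.aestronglyMeasurable C
    (.of_forall fun p ↦ hC p.1 (mem_univ _))

/-- Existence of Mather measures. -/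
theorem matherMeasures_nonempty [Nonempty M] (hLc : Continuous L)
    (hL : ∀ K, ∃ R, ∀ p, R ≤ vnorm g p → K * vnorm g p ≤ L p) (h : H1 M) :
    (matherMeasures g L h).Nonempty := by
  obtain ⟨c, hc⟩ := exists_represents h
  let φ : {f : M → ℝ // ContMDiff 𝓘(ℝ, E) 𝓘(ℝ, ℝ) 1 f} ⊕
      {η : ∀ x : M, TangentSpace 𝓘(ℝ, E) x →L[ℝ] ℝ // IsClosedForm η} →
      ∀ x : M, TangentSpace 𝓘(ℝ, E) x →L[ℝ] ℝ :=
    Sum.elim (fun f ↦ differential f.1) fun η ↦ η.1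
  have hφ : ∀ i, IsContinuousForm (φ i) := by
    rintro (f | η)
    · exact isContinuousForm_differential f.2
    · exact η.2.isContinuousForm
  let r : {f : M → ℝ // ContMDiff 𝓘(ℝ, E) 𝓘(ℝ, ℝ) 1 f} ⊕
      {η : ∀ x : M, TangentSpace 𝓘(ℝ, E) x →L[ℝ] ℝ // IsClosedForm η} → ℝ :=
    Sum.elim (fun _ ↦ 0) fun η ↦ c.sum fun σ s ↦ s * integralOver η.1 σ
  have hN := continuous_vnorm g
  have hcomp := isCompact_setOf_vnorm_le g
  -- The cycle in `HasRotationVector` depends on the measure; `IsClosedForm.pairing_eq` replaces it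
  -- by the fixed cycle `c`. The first moment is finite because the action is.
  have hA : admissible g L h = {μ | IsProbabilityMeasure μ ∧ Integrable L μ ∧
      ∀ i, ∫ p, φ i p.1 p.2 ∂μ = r i} := by
    ext μ
    constructor
    · rintro ⟨h1, ⟨c', hc', h2⟩, h3⟩
      refine ⟨h1.prob, h3, ?_⟩
      rintro (f | η)
      · exact h1.closed f.1 f.2
      · exact (h2 η.1 η.2).trans (η.2.pairing_eq hc' hc)
    · rintro ⟨h1, h2, h3⟩
      exact ⟨⟨h1, integrable_of_integrable_superlinear hN hcomp hLc hL (vnorm_nonneg g) h2,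
        fun f hf ↦ h3 (Sum.inl ⟨f, hf⟩)⟩, ⟨c, hc, fun η hη ↦ h3 (Sum.inr ⟨η, hη⟩)⟩, h2⟩
  have hne : (admissible g L h).Nonempty := by
    obtain ⟨μ, h1, h2, h3⟩ := exists_isClosedMeasure_hasRotationVector g h
    exact ⟨μ, h1, h2, h3.integrable hLc⟩
  obtain ⟨μ, hμ, hleast⟩ := exists_isLeast_integral hN (vnorm_nonneg g) hcomp hLc hL
    (fun i p ↦ φ i p.1 p.2) (fun i ↦ (hφ i).continuous) (fun i ↦ (hφ i).exists_abs_le g) r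
    (admissible g L h) hA hne
  exact ⟨μ, hμ, hleast⟩

omit [FiniteDimensional ℝ E] [T2Space M] [CompactSpace M] in
lemma beta_eq_of_mem {h : H1 M} {μ : Measure (TangentBundle 𝓘(ℝ, E) M)}
    (hμ : μ ∈ matherMeasures g L h) : beta g L h = ∫ p, L p ∂μ :=
  hμ.2.csInf_eq

omit [FiniteDimensional ℝ E] [T2Space M] [CompactSpace M] in
lemma mem_matherMeasures_of_eq_beta {h : H1 M} (hne : (matherMeasures g L h).Nonempty)
    {μ : Measure (TangentBundle 𝓘(ℝ, E) M)} (hμ : μ ∈ admissible g L h)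
    (hβ : ∫ p, L p ∂μ = beta g L h) : μ ∈ matherMeasures g L h := by
  obtain ⟨ν, hν⟩ := hne
  refine ⟨hμ, ?_⟩
  rw [hβ, beta_eq_of_mem hν]
  exact hν.2

omit [FiniteDimensional ℝ E] [T2Space M] in
lemma admissible_perturb {V : M → ℝ} (hV : Continuous V) (h : H1 M) :
    admissible g (perturb L V) h = admissible g L h := by
  ext μ
  refine and_congr_right fun h1 ↦ and_congr_right fun _ ↦ ?_
  have := h1.prob
  exact integrable_add_iff_integrable_left (integrable_comp_proj hV)

omit [FiniteDimensional ℝ E] [T2Space M] in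
lemma integral_perturb {V : M → ℝ} (hV : Continuous V) {h : H1 M}
    {μ : Measure (TangentBundle 𝓘(ℝ, E) M)} (hμ : μ ∈ admissible g L h) :
    ∫ p, perturb L V p ∂μ = ∫ p, L p ∂μ + ∫ p, V p.1 ∂μ := by
  have := hμ.1.prob
  exact integral_add hμ.2.2 (integrable_comp_proj hV)

omit [FiniteDimensional ℝ E] [T2Space M] in
lemma beta_perturb_le {V : M → ℝ} (hV : Continuous V) (hV0 : ∀ x, V x ≤ 0) {h : H1 M}
    (h1 : (matherMeasures g L h).Nonempty) (h2 : (matherMeasures g (perturb L V) h).Nonempty) :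
    beta g (perturb L V) h ≤ beta g L h := by
  obtain ⟨μ, hμ⟩ := h1
  obtain ⟨ν, hν⟩ := h2
  rw [beta_eq_of_mem hμ, beta_eq_of_mem hν]
  refine (hν.2.2 ⟨μ, by rw [admissible_perturb hV]; exact hμ.1, rfl⟩).trans ?_
  have h3 : ∫ p, V p.1 ∂μ ≤ 0 := integral_nonpos fun p ↦ hV0 p.1
  change ∫ p, perturb L V p ∂μ ≤ _
  rw [integral_perturb hV hμ.1]
  linarith

omit [FiniteDimensional ℝ E] [T2Space M] in
/-- If the perturbation does not change `β` at `h`, every Mather measure remains a Mather measure and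
the perturbation vanishes on its support. -/
lemma mem_matherMeasures_perturb {V : M → ℝ} (hV : Continuous V)
    (hV0 : ∀ x, V x ≤ 0) {h : H1 M} (h2 : (matherMeasures g (perturb L V) h).Nonempty)
    (hβ : beta g (perturb L V) h = beta g L h) {μ : Measure (TangentBundle 𝓘(ℝ, E) M)}
    (hμ : μ ∈ matherMeasures g L h) :
    μ ∈ matherMeasures g (perturb L V) h ∧ ∀ p ∈ μ.support, V p.1 = 0 := by
  have hprob := hμ.1.1.prob
  have hadm : μ ∈ admissible g (perturb L V) h := by
    rw [admissible_perturb hV]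
    exact hμ.1
  have h3 : ∫ p, V p.1 ∂μ ≤ 0 := integral_nonpos fun p ↦ hV0 p.1
  have h4 : beta g (perturb L V) h ≤ ∫ p, perturb L V p ∂μ := by
    obtain ⟨ν, hν⟩ := h2
    rw [beta_eq_of_mem hν]
    exact hν.2.2 ⟨μ, hadm, rfl⟩
  have h5 := integral_perturb hV hμ.1
  have h6 := beta_eq_of_mem hμ
  refine ⟨mem_matherMeasures_of_eq_beta h2 hadm (by linarith), ?_⟩
  -- Equality of the two minima leaves no room in `β_{L+V} ≤ ∫ L dμ + ∫ V dμ ≤ ∫ L dμ`. Hence `V =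
  -- 0` almost everywhere, and its closed zero set contains the support.
  have h7 : ∫ p, - V p.1 ∂μ = 0 := by
    rw [integral_neg]
    linarith
  have h8 : (fun p : TangentBundle 𝓘(ℝ, E) M ↦ - V p.1) =ᵐ[μ] 0 :=
    (integral_eq_zero_iff_of_nonneg (fun p : TangentBundle 𝓘(ℝ, E) M ↦ neg_nonneg.2 (hV0 p.1))
      (integrable_comp_proj hV).neg).1 h7
  refine Measure.support_subset_of_isClosed
    (isClosed_eq (continuous_comp_proj hV) continuous_const) ?_
  filter_upwards [h8] with p hp
  exact neg_eq_zero.1 hp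

lemma beta_perturb_eq_iff {V : M → ℝ} (hV : Continuous V) (hV0 : ∀ x, V x ≤ 0) {h : H1 M}
    (h1 : (matherMeasures g L h).Nonempty) (h2 : (matherMeasures g (perturb L V) h).Nonempty) :
    beta g (perturb L V) h = beta g L h ↔
      matherMeasures g L h ⊆ matherMeasures g (perturb L V) h ∧
      (∀ p ∈ matherSet g L h, V p.1 = 0) ∧ matherSet g L h ⊆ matherSet g (perturb L V) h := by
  refine ⟨fun hβ ↦ ?_, fun ⟨hsub, hzero, _⟩ ↦ ?_⟩
  · have hsub : matherMeasures g L h ⊆ matherMeasures g (perturb L V) h := fun μ hμ ↦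
      (mem_matherMeasures_perturb hV hV0 h2 hβ hμ).1
    refine ⟨hsub, ?_, closure_mono (biUnion_mono hsub fun _ _ ↦ subset_rfl)⟩
    refine closure_minimal (t := {p : TangentBundle 𝓘(ℝ, E) M | V p.1 = 0}) ?_
      (isClosed_eq (continuous_comp_proj hV) continuous_const)
    exact iUnion₂_subset fun μ hμ ↦ (mem_matherMeasures_perturb hV hV0 h2 hβ hμ).2
  · obtain ⟨μ, hμ⟩ := h1
    rw [beta_eq_of_mem hμ, beta_eq_of_mem (hsub hμ), integral_perturb hV hμ.1]
    have := secondCountableTopology_tangentBundle g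
    have h3 : ∀ᵐ p ∂μ, V p.1 = 0 := by
      filter_upwards [Measure.support_mem_ae (μ := μ)] with p hp
      exact hzero p (subset_closure (mem_iUnion₂.2 ⟨μ, hμ, hp⟩))
    rw [integral_eq_zero_of_ae h3, add_zero]

end Mather

/-! ### The flat torus -/

section FlatTorus

variable {n : ℕ}

local notation "𝔼" => EuclideanSpace ℝ (Fin n)
local notation "𝕋" => UnitAddTorus (Fin n)
local notation "𝕀" => modelWithCornersSelf ℝ (EuclideanSpace ℝ (Fin n))

lemma chartAt_torus_symm (x : 𝕋) : ⇑(chartAt 𝔼 x).symm = torusProj n :=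
  funext fun a ↦ chart_mem_atlas 𝔼 x a

lemma torusProj_add (a b : 𝔼) : torusProj n (a + b) = torusProj n a + torusProj n b := by
  funext i
  simp [torusProj]

lemma continuous_torusProj : Continuous (torusProj n) :=
  (torusProj_isLocalHomeomorph n).continuous

/-- Read in a chart the projection is locally a translation. Hence the canonical identification of
the tangent bundle of the torus is the one given by the fibre type itself. -/
lemma hasMFDerivAt_torusProj (a : 𝔼) :
    HasMFDerivAt 𝕀 𝕀 (torusProj n) a (ContinuousLinearMap.id ℝ 𝔼) := by
  refine ⟨continuous_torusProj.continuousAt, ?_⟩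
  have h1 : HasFDerivAt (fun b ↦ chartAt 𝔼 (torusProj n a) (torusProj n b))
      (ContinuousLinearMap.id ℝ 𝔼) a :=
    ((hasFDerivAt_id a).add_const _).congr_of_eventuallyEq (torus_section_eventuallyEq n
      (chartAt 𝔼 (torusProj n a)) (fun b ↦ congrFun (chartAt_torus_symm _) b) a
      (mem_chart_source _ _))
  exact h1.hasFDerivWithinAt

lemma tangentMap_torusProj (a v : 𝔼) :
    tangentMap 𝕀 𝕀 (torusProj n) ⟨a, v⟩ = (⟨torusProj n a, v⟩ : TangentBundle 𝕀 𝕋) := by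
  have h : mfderiv 𝕀 𝕀 (torusProj n) a = ContinuousLinearMap.id ℝ 𝔼 :=
    (hasMFDerivAt_torusProj a).mfderiv
  unfold tangentMap
  exact congrArg (fun A : 𝔼 →L[ℝ] 𝔼 ↦ (⟨torusProj n a, A v⟩ : TangentBundle 𝕀 𝕋)) h

/-- The constant form with coefficients `C`. -/
def constForm (C : 𝔼 →L[ℝ] ℝ) (x : 𝕋) : TangentSpace 𝕀 x →L[ℝ] ℝ := C

/-- The pullback of a form on the torus to `ℝⁿ`. -/
def pullbackForm (η : ∀ x : 𝕋, TangentSpace 𝕀 x →L[ℝ] ℝ) (a : 𝔼) : 𝔼 →L[ℝ] ℝ :=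
  η (torusProj n a)

lemma hasFDerivAt_comp_torusProj {f : 𝕋 → ℝ} (hf : ContMDiff 𝕀 𝓘(ℝ, ℝ) 1 f) (a : 𝔼) :
    HasFDerivAt (f ∘ torusProj n) (pullbackForm (differential f) a) a :=
  ((hasMFDerivAt_differential hf _).comp _ (hasMFDerivAt_torusProj _)).hasFDerivAt

lemma coeffInChart_torus (η : ∀ x : 𝕋, TangentSpace 𝕀 x →L[ℝ] ℝ) (x₀ : 𝕋) (y : 𝔼) :
    coeffInChart η x₀ y = pullbackForm η y := by
  have h : mfderiv 𝕀 𝕀 (torusProj n) y = ContinuousLinearMap.id ℝ 𝔼 :=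
    (hasMFDerivAt_torusProj y).mfderiv
  unfold coeffInChart
  rw [chartAt_torus_symm]
  ext v
  exact congrArg (fun A : 𝔼 →L[ℝ] 𝔼 ↦ η (torusProj n y) (A v)) h

/-- Constant forms have constant coefficients in every chart, and the forms `⟪w, ·⟫` separate
vectors. -/
lemma trivializationAt_torus (x₀ x : 𝕋) (hx : x ∈ (chartAt 𝔼 x₀).source) (v : 𝔼) :
    (trivializationAt 𝔼 (TangentSpace 𝕀 : 𝕋 → Type) x₀ ⟨x, v⟩).2 = v := by
  refine ext_inner_left ℝ fun w ↦ ?_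
  have h := form_eq_coeffInChart (E := 𝔼) (M := 𝕋) (constForm (innerSL ℝ w)) x₀
    (p := (⟨x, v⟩ : TangentBundle 𝕀 𝕋)) hx
  rw [coeffInChart_torus] at h
  exact h.symm

/-- The section of the tangent bundle of the torus with constant value `ρ`. -/
def constSection (ρ : 𝔼) (x : 𝕋) : TangentBundle 𝕀 𝕋 := ⟨x, ρ⟩

lemma continuous_constSection (ρ : 𝔼) : Continuous (constSection ρ) := by
  rw [continuous_iff_continuousAt]
  intro x
  rw [FiberBundle.continuousAt_totalSpace]
  refine ⟨continuousAt_id, ContinuousAt.congr (f := fun _ ↦ ρ) continuousAt_const ?_⟩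
  filter_upwards [(chartAt 𝔼 x).open_source.mem_nhds (mem_chart_source 𝔼 x)] with y hy
  exact (trivializationAt_torus x y hy ρ).symm

lemma isContinuousForm_constForm (C : 𝔼 →L[ℝ] ℝ) : IsContinuousForm (constForm C) := by
  intro x₀
  have : coeffInChart (constForm C) x₀ = fun _ ↦ C := funext fun y ↦ coeffInChart_torus _ _ _
  rw [this]
  exact continuousOn_const

/-- The velocity of a tangent vector of the torus. -/
def velocity (p : TangentBundle 𝕀 𝕋) : 𝔼 := p.2

lemma integrable_velocity (g : Metric 𝔼 𝕋) {μ : Measure (TangentBundle 𝕀 𝕋)}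
    (hμ : Integrable (vnorm g) μ) : Integrable velocity μ := by
  have h1 : ∀ i, Integrable (fun p ↦ velocity p i) μ := fun i ↦ by
    have h := isContinuousForm_constForm (EuclideanSpace.proj i : 𝔼 →L[ℝ] ℝ)
    obtain ⟨C, hC⟩ := h.exists_abs_le g
    exact integrable_of_abs_le_mul h.continuous hC hμ
  have h2 : (velocity : TangentBundle 𝕀 𝕋 → 𝔼) =
      fun p ↦ ∑ i, velocity p i • EuclideanSpace.basisFun (Fin n) ℝ i := by
    funext p
    exact ((EuclideanSpace.basisFun (Fin n) ℝ).sum_repr (velocity p)).symm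
  rw [h2]
  exact integrable_finsetSum _ fun i _ ↦ (h1 i).smul_const _

instance isProbabilityMeasure_torus : IsProbabilityMeasure (volume : Measure 𝕋) := by
  have : IsProbabilityMeasure (volume : Measure UnitAddCircle) := ⟨UnitAddCircle.measure_univ⟩
  exact Measure.pi.instIsProbabilityMeasure _

/-- Average over translations by `t • ρ`, `0 ≤ t ≤ 1`. Translation invariance leaves the integral
unchanged, while integrating in `t` first gives `f (x + ρ) - f x`, of mean zero. -/
lemma integral_differential_const {f : 𝕋 → ℝ} (hf : ContMDiff 𝕀 𝓘(ℝ, ℝ) 1 f) (ρ : 𝔼) :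
    ∫ x : 𝕋, differential (E := 𝔼) f x ρ = 0 := by
  let D : 𝕋 → ℝ := fun x ↦ differential (E := 𝔼) f x ρ
  have hD : Continuous D :=
    (isContinuousForm_differential (E := 𝔼) hf).continuous.comp (continuous_constSection ρ)
  have hftc : ∀ x, ∫ t in (0 : ℝ)..1, D (x + torusProj n (t • ρ)) = f (x + torusProj n ρ) - f x := by
    intro x
    obtain ⟨a, rfl⟩ := torusProj_surjective n x
    have h1 : ∀ t : ℝ, HasDerivAt (fun t : ℝ ↦ f (torusProj n (a + t • ρ)))
        (D (torusProj n (a + t • ρ))) t := by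
      intro t
      have h4 : HasDerivAt (fun t : ℝ ↦ a + t • ρ) ρ t := by
        simpa using ((hasDerivAt_id t).smul_const ρ).const_add a
      exact (hasFDerivAt_comp_torusProj hf _).comp_hasDerivAt t h4
    have hc : Continuous fun t : ℝ ↦ D (torusProj n (a + t • ρ)) :=
      hD.comp (continuous_torusProj.comp (by fun_prop))
    have h2 := intervalIntegral.integral_eq_sub_of_hasDerivAt (a := 0) (b := 1)
      (fun t _ ↦ h1 t) (hc.intervalIntegrable 0 1)
    simpa [torusProj_add] using h2
  obtain ⟨B, hB⟩ := isCompact_univ.exists_bound_of_continuousOn hD.continuousOn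
  have : IsFiniteMeasure (volume.restrict (uIoc (0 : ℝ) 1)) := by
    rw [uIoc_of_le zero_le_one]
    infer_instance
  have hswap := intervalIntegral_integral_swap (μ := (volume : Measure 𝕋)) (a := 0) (b := 1)
    (f := fun t x ↦ D (x + torusProj n (t • ρ))) (by
      refine .of_bound (C := B) (Continuous.aestronglyMeasurable ?_)
        (.of_forall fun q ↦ hB _ (mem_univ _))
      exact hD.comp (continuous_snd.add
        (continuous_torusProj.comp (continuous_fst.smul continuous_const))))
  simp only [hftc, integral_add_right_eq_self] at hswap
  have hfi : Integrable f (volume : Measure 𝕋) :=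
    hf.continuous.integrable_of_hasCompactSupport (HasCompactSupport.of_compactSpace f)
  rw [integral_sub (hfi.comp_add_right _) hfi, integral_add_right_eq_self, sub_self] at hswap
  simpa using hswap

lemma torusProj_add_intCast (a : 𝔼) (m : Fin n → ℤ) :
    torusProj n (a + WithLp.toLp 2 fun i ↦ (m i : ℝ)) = torusProj n a :=
  (torusProj_eq_iff n).2 fun i ↦ ⟨m i, by simp⟩

lemma exists_intCast_of_torusProj_eq {a b : 𝔼} (h : torusProj n a = torusProj n b) :
    ∃ m : Fin n → ℤ, a = b + WithLp.toLp 2 fun i ↦ (m i : ℝ) := by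
  choose m hm using (torusProj_eq_iff n).1 h
  refine ⟨m, ?_⟩
  ext i
  simp [hm]

/-- Closed forms on the torus pull back to exact forms on `ℝⁿ`. -/
lemma IsClosedForm.exists_primitive_torus {η : ∀ x : 𝕋, TangentSpace 𝕀 x →L[ℝ] ℝ}
    (hη : IsClosedForm η) :
    ∃ F : 𝔼 → ℝ, ContDiff ℝ 1 F ∧ ∀ a, HasFDerivAt F (pullbackForm η a) a := by
  let κ : 𝔼 → 𝔼 →L[ℝ] ℝ := pullbackForm η
  have hloc : ∀ a, ContDiffAt ℝ ∞ κ a ∧ ∀ u w, fderiv ℝ κ a u w = fderiv ℝ κ a w u := by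
    intro a
    let e := chartAt 𝔼 (torusProj n a)
    let b := e (torusProj n a)
    have hb : b ∈ e.target := mem_chart_target 𝔼 _
    have hba : torusProj n b = torusProj n a := by
      rw [← congrFun (chartAt_torus_symm (torusProj n a)) b]
      exact e.left_inv (mem_chart_source 𝔼 _)
    have hco : coeffInChart η (torusProj n a) = κ := funext fun y ↦ coeffInChart_torus η _ y
    have hs := hη.smooth (torusProj n a)
    have hc := hη.closed (torusProj n a) b hb
    rw [hco] at hs hc
    -- The chart value `b` need not be the given lift `a`, but differs from it by an integer vector;
    -- periodicity of `κ` carries smoothness and symmetry from `b` to `a`.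
    obtain ⟨m, hm⟩ := exists_intCast_of_torusProj_eq hba
    let k : 𝔼 := WithLp.toLp 2 fun i ↦ (m i : ℝ)
    have hper : κ = fun y ↦ κ (y + k) := by
      funext y
      change pullbackForm η y = pullbackForm η (y + k)
      rw [pullbackForm, pullbackForm, torusProj_add_intCast]
    have hsb : ContDiffAt ℝ ∞ κ (a + k) := by
      have : a + k = b := hm.symm
      rw [this]
      exact hs.contDiffAt (e.open_target.mem_nhds hb)
    refine ⟨?_, ?_⟩
    · rw [hper]
      exact ContDiffAt.comp (g := κ) (f := fun y ↦ y + k) a hsb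
        (contDiff_id.add contDiff_const).contDiffAt
    · intro u w
      have h1 : fderiv ℝ κ a = fderiv ℝ κ b := by
        have : b = a + k := hm
        rw [this]
        conv_lhs => rw [hper]
        exact fderiv_comp_add_right k
      rw [h1]
      exact hc u w
  obtain ⟨F, hF⟩ := convex_univ.exists_forall_hasFDerivAt_of_fderiv_symmetric (s := (univ : Set 𝔼))
    isOpen_univ
    (show DifferentiableOn ℝ κ univ from
      fun a _ ↦ ((hloc a).1.differentiableAt (by simp)).differentiableWithinAt)
    fun a _ ↦ (hloc a).2
  refine ⟨F, contDiff_one_iff_fderiv.2 ⟨fun a ↦ (hF a (mem_univ a)).differentiableAt, ?_⟩,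
    fun a ↦ hF a (mem_univ a)⟩
  have : fderiv ℝ F = κ := funext fun a ↦ (hF a (mem_univ a)).fderiv
  rw [this]
  exact continuous_iff_continuousAt.2 fun a ↦ (hloc a).1.continuousAt

/-- Every closed form on the torus is cohomologous to a constant form. -/
lemma IsClosedForm.exists_eq_const_add_differential {η : ∀ x : 𝕋, TangentSpace 𝕀 x →L[ℝ] ℝ}
    (hη : IsClosedForm η) :
    ∃ C : 𝔼 →L[ℝ] ℝ, ∃ f : 𝕋 → ℝ, ContMDiff 𝕀 𝓘(ℝ, ℝ) 1 f ∧
      ∀ x, η x = constForm C x + differential f x := by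
  obtain ⟨F, hF1, hF⟩ := hη.exists_primitive_torus
  let z : (Fin n → ℤ) → 𝔼 := fun m ↦ WithLp.toLp 2 fun i ↦ (m i : ℝ)
  have hz0 : z 0 = 0 := by
    ext i
    simp [z]
  have hzadd : ∀ m l, z (m + l) = z m + z l := by
    intro m l
    ext i
    simp [z]
  -- The pulled-back form is periodic, so this increment has zero derivative in `a`. The periods are
  -- therefore additive in `m`.
  have hper : ∀ m a, F (a + z m) - F a = F (z m) - F 0 := by
    intro m a
    have hd : ∀ b, HasFDerivAt (fun b ↦ F (b + z m) - F b) (0 : 𝔼 →L[ℝ] ℝ) b := by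
      intro b
      have h1 := (hF (b + z m)).comp b ((hasFDerivAt_id b).add_const (z m))
      have h2 := h1.sub (hF b)
      have h3 : (pullbackForm η (b + z m)).comp (ContinuousLinearMap.id ℝ 𝔼) -
          pullbackForm η b = 0 := by
        rw [ContinuousLinearMap.comp_id, sub_eq_zero, pullbackForm, pullbackForm,
          torusProj_add_intCast]
      rw [← h3]
      exact h2
    have := is_const_of_fderiv_eq_zero (𝕜 := ℝ) (fun b ↦ (hd b).differentiableAt)
      (fun b ↦ (hd b).fderiv) a 0
    simpa using this
  let c : (Fin n → ℤ) →+ ℝ :=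
    { toFun := fun m ↦ F (z m) - F 0
      map_zero' := by rw [hz0, sub_self]
      map_add' := fun m l ↦ by
        have := hper l (z m)
        rw [hzadd]
        linarith }
  -- The linear form with the same periods as `F`; hence `F - C` is periodic and descends to the
  -- torus.
  let C : 𝔼 →L[ℝ] ℝ := ∑ i, c (Pi.single i 1) • (EuclideanSpace.proj i : 𝔼 →L[ℝ] ℝ)
  have hC : ∀ m, C (z m) = c m := by
    intro m
    have h1 : m = ∑ i, m i • (Pi.single i 1 : Fin n → ℤ) := by
      funext j
      simp [Finset.sum_apply, Pi.single_apply]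
    conv_rhs => rw [h1, map_sum]
    simp only [map_zsmul, C, sum_apply, smul_apply]
    refine Finset.sum_congr rfl fun i _ ↦ ?_
    simp [z, mul_comm]
  let G : 𝔼 → ℝ := fun a ↦ F a - C a
  have hG1 : ContDiff ℝ 1 G := hF1.sub C.contDiff
  have hGper : ∀ a b, torusProj n a = torusProj n b → G a = G b := by
    intro a b hab
    obtain ⟨m, hm⟩ := exists_intCast_of_torusProj_eq hab
    have h1 := hper m b
    have h2 : C (z m) = F (z m) - F 0 := hC m
    have hm' : a = b + z m := hm
    change F a - C a = F b - C b
    rw [hm', map_add]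
    linarith
  let f : 𝕋 → ℝ := fun x ↦ G (torusProj_surjective n x).choose
  have hf : ∀ a, f (torusProj n a) = G a := fun a ↦
    hGper _ _ (torusProj_surjective n (torusProj n a)).choose_spec
  have hf1 : ContMDiff 𝕀 𝓘(ℝ, ℝ) 1 f := by
    have : IsManifold 𝕀 1 𝕋 := IsManifold.of_le (n := ∞) (by simp)
    intro x
    have h1 : ContMDiffAt 𝕀 𝓘(ℝ, ℝ) 1 (G ∘ chartAt 𝔼 x) x :=
      hG1.contMDiff.contMDiffAt.comp x
        ((contMDiffOn_chart (I := 𝕀) (x := x)).contMDiffAt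
          ((chartAt 𝔼 x).open_source.mem_nhds (mem_chart_source 𝔼 x)))
    refine h1.congr_of_eventuallyEq ?_
    filter_upwards [(chartAt 𝔼 x).open_source.mem_nhds (mem_chart_source 𝔼 x)] with y hy
    have h2 : torusProj n (chartAt 𝔼 x y) = y := by
      rw [← congrFun (chartAt_torus_symm x)]
      exact (chartAt 𝔼 x).left_inv hy
    change f y = G (chartAt 𝔼 x y)
    rw [← hf, h2]
  refine ⟨C, f, hf1, fun x ↦ ?_⟩
  obtain ⟨a, rfl⟩ := torusProj_surjective n x
  have h1 := hasFDerivAt_comp_torusProj hf1 a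
  have h2 : f ∘ torusProj n = G := funext hf
  rw [h2] at h1
  have h3 := h1.unique ((hF a).sub C.hasFDerivAt)
  exact (sub_eq_iff_eq_add'.1 h3.symm)

end FlatTorus

/-! ### Uniform Mather measures on the flat torus -/

section FlatTorusMather

variable {n : ℕ}

local notation "𝔼" => EuclideanSpace ℝ (Fin n)
local notation "𝕋" => UnitAddTorus (Fin n)
local notation "𝕀" => modelWithCornersSelf ℝ (EuclideanSpace ℝ (Fin n))

/-- The normalized Lebesgue measure on the torus, with constant velocity `ρ`. -/
def constVelocityMeasure (ρ : 𝔼) : Measure (TangentBundle 𝕀 𝕋) :=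
  (volume : Measure 𝕋).map (constSection ρ)

lemma integral_constVelocityMeasure (ρ : 𝔼) {f : TangentBundle 𝕀 𝕋 → ℝ} (hf : Continuous f) :
    ∫ p, f p ∂(constVelocityMeasure ρ) = ∫ x, f (constSection ρ x) :=
  integral_map (continuous_constSection ρ).aemeasurable hf.measurable.aestronglyMeasurable

lemma isProbabilityMeasure_constVelocityMeasure (ρ : 𝔼) :
    IsProbabilityMeasure (constVelocityMeasure ρ) :=
  Measure.isProbabilityMeasure_map (continuous_constSection ρ).aemeasurable

lemma integrable_constVelocityMeasure (ρ : 𝔼) {f : TangentBundle 𝕀 𝕋 → ℝ} (hf : Continuous f) :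
    Integrable f (constVelocityMeasure ρ) := by
  rw [constVelocityMeasure, integrable_map_measure hf.measurable.aestronglyMeasurable
    (continuous_constSection ρ).aemeasurable]
  exact (hf.comp (continuous_constSection ρ)).integrable_of_hasCompactSupport
    (HasCompactSupport.of_compactSpace _)

lemma integral_differential_constVelocityMeasure (ρ : 𝔼) {f : 𝕋 → ℝ}
    (hf : ContMDiff 𝕀 𝓘(ℝ, ℝ) 1 f) :
    ∫ p, differential f p.1 p.2 ∂(constVelocityMeasure ρ) = 0 :=
  (integral_constVelocityMeasure ρ (isContinuousForm_differential hf).continuous).trans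
    (integral_differential_const hf ρ)

lemma isClosedMeasure_constVelocityMeasure (g : Metric 𝔼 𝕋) (ρ : 𝔼) :
    IsClosedMeasure g (constVelocityMeasure ρ) :=
  ⟨isProbabilityMeasure_constVelocityMeasure ρ,
    integrable_constVelocityMeasure ρ (continuous_vnorm g),
    fun _ hf ↦ integral_differential_constVelocityMeasure ρ hf⟩

/-- Lebesgue measure charges every nonempty open set, so this support lies over the whole torus. -/
lemma support_constVelocityMeasure (ρ : 𝔼) (x : 𝕋) :
    constSection ρ x ∈ (constVelocityMeasure ρ).support := by
  rw [Measure.support_eq_forall_isOpen]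
  intro U hxU hU
  rw [constVelocityMeasure, Measure.map_apply (continuous_constSection ρ).measurable
    hU.measurableSet]
  exact (hU.preimage (continuous_constSection ρ)).measure_pos _ ⟨x, hxU⟩

/-- The uniform measure with the mean velocity of a closed measure has the same rotation vector. -/
lemma HasRotationVector.constVelocityMeasure {g : Metric 𝔼 𝕋} {μ : Measure (TangentBundle 𝕀 𝕋)}
    (hμ : IsClosedMeasure g μ) {h : H1 𝕋} (hh : HasRotationVector μ h) :
    HasRotationVector (constVelocityMeasure (∫ p, velocity p ∂μ)) h := by
  obtain ⟨c, hc, hη⟩ := hh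
  refine ⟨c, hc, fun η hηc ↦ ?_⟩
  rw [← hη η hηc]
  -- Both measures integrate the exact part to zero, and the constant part sees only the mean
  -- velocity, which they share.
  obtain ⟨C, f, hf, hCf⟩ := hηc.exists_eq_const_add_differential
  have hvel := integrable_velocity g hμ.firstMoment
  have hdc := isContinuousForm_differential (E := 𝔼) hf
  have hCc : Continuous fun p : TangentBundle 𝕀 𝕋 ↦ C (velocity p) :=
    (isContinuousForm_constForm C).continuous
  have h0 : ∀ p : TangentBundle 𝕀 𝕋, (η p.1 p.2 : ℝ) = C (velocity p) + differential f p.1 p.2 := by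
    intro p
    rw [hCf]
    rfl
  have h1 : ∫ p, (η p.1 p.2 : ℝ) ∂μ = C (∫ p, velocity p ∂μ) := by
    have hd : Integrable (fun p : TangentBundle 𝕀 𝕋 ↦ (differential f p.1 p.2 : ℝ)) μ := by
      obtain ⟨B, hB⟩ := hdc.exists_abs_le g
      exact integrable_of_abs_le_mul hdc.continuous hB hμ.firstMoment
    simp_rw [h0]
    rw [integral_add (C.integrable_comp hvel) hd, C.integral_comp_comm hvel]
    rw [show ∫ p : TangentBundle 𝕀 𝕋, (differential f p.1 p.2 : ℝ) ∂μ = 0 from hμ.closed f hf,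
      add_zero]
  have := isProbabilityMeasure_constVelocityMeasure (∫ p, velocity p ∂μ)
  simp_rw [h1, h0]
  rw [integral_add (integrable_constVelocityMeasure _ hCc)
    (integrable_constVelocityMeasure _ hdc.continuous),
    integral_differential_constVelocityMeasure _ hf, add_zero]
  refine (integral_constVelocityMeasure _ hCc).trans ?_
  change ∫ _ : 𝕋, C (∫ p, velocity p ∂μ) = _
  simp

/-- The tangent hyperplane of a strictly convex function lies below its graph. -/
lemma add_fderiv_le_of_iteratedFDeriv_pos {F : Type*} [NormedAddCommGroup F] [NormedSpace ℝ F]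
    {ℓ : F → ℝ} (hℓ : ContDiff ℝ 2 ℓ)
    (hpos : ∀ v w : F, w ≠ 0 → 0 < iteratedFDeriv ℝ 2 ℓ v ![w, w]) (x y : F) :
    ℓ x + fderiv ℝ ℓ x (y - x) ≤ ℓ y := by
  set w := y - x with hw
  have hd1 : Differentiable ℝ ℓ := hℓ.differentiable (by simp)
  have hd2 : Differentiable ℝ (fderiv ℝ ℓ) :=
    (hℓ.fderiv_right (m := 1) (by norm_num)).differentiable (by simp)
  have hline : ∀ t : ℝ, HasDerivAt (fun t : ℝ ↦ x + t • w) w t := fun t ↦ by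
    simpa using ((hasDerivAt_id t).smul_const w).const_add x
  have h1 : ∀ t : ℝ, HasDerivAt (fun t : ℝ ↦ ℓ (x + t • w)) (fderiv ℝ ℓ (x + t • w) w) t :=
    fun t ↦ (hd1 _).hasFDerivAt.comp_hasDerivAt t (hline t)
  have h2 : ∀ t : ℝ, HasDerivAt (fun t : ℝ ↦ fderiv ℝ ℓ (x + t • w) w)
      (fderiv ℝ (fderiv ℝ ℓ) (x + t • w) w w) t := fun t ↦ by
    have := ((hd2 _).hasFDerivAt.comp_hasDerivAt t (hline t)).clm_apply (hasDerivAt_const t w)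
    simpa using this
  have h3 : deriv (fun t : ℝ ↦ ℓ (x + t • w)) = fun t ↦ fderiv ℝ ℓ (x + t • w) w :=
    funext fun t ↦ (h1 t).deriv
  -- Convexity on the line through `x` and `y` suffices: the derivative at `0` is at most the slope
  -- between `0` and `1`.
  have hconv : ConvexOn ℝ univ (fun t : ℝ ↦ ℓ (x + t • w)) := by
    refine convexOn_univ_of_deriv2_nonneg (fun t ↦ (h1 t).differentiableAt) ?_ fun t ↦ ?_
    · rw [h3]
      exact fun t ↦ (h2 t).differentiableAt
    · rw [Function.iterate_succ, Function.iterate_one, Function.comp_apply, h3, (h2 t).deriv]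
      rcases eq_or_ne w 0 with h0 | h0
      · simp [h0]
      · have := hpos (x + t • w) w h0
        rw [iteratedFDeriv_two_apply] at this
        exact this.le
  have h4 := hconv.le_slope_of_hasDerivAt (mem_univ 0) (mem_univ 1) one_pos (h1 0)
  rw [slope_def_field] at h4
  simp only [zero_smul, add_zero, one_smul, sub_zero, div_one, hw, add_sub_cancel] at h4
  linarith

lemma contDiff_fiber {L : TangentBundle 𝕀 𝕋 → ℝ}
    (hL : ContMDiff (ModelWithCorners.tangent 𝕀) 𝓘(ℝ, ℝ) 2 L) (x : 𝕋) :
    ContDiff ℝ 2 (fun v : 𝔼 ↦ L ⟨x, v⟩) := by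
  have h : ContMDiff 𝕀 (ModelWithCorners.tangent 𝕀) 2
      (fun v : 𝔼 ↦ (⟨x, v⟩ : TangentBundle 𝕀 𝕋)) := by
    intro v
    refine contMDiffAt_totalSpace.2 ⟨contMDiffAt_const, ?_⟩
    refine ContMDiffAt.congr_of_eventuallyEq (f := fun v : 𝔼 ↦ v) contMDiffAt_id
      (.of_forall fun w ↦ ?_)
    exact trivializationAt_torus x x (mem_chart_source 𝔼 x) w
  exact (hL.comp h).contDiff

/-- For a Lagrangian depending only on the velocity, some Mather measure is uniform on the torus. -/
lemma exists_constVelocityMeasure_mem_matherMeasures {g : Metric 𝔼 𝕋}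
    {L : TangentBundle 𝕀 𝕋 → ℝ} (hL : IsTonelli g L) {ℓ : 𝔼 → ℝ}
    (hLℓ : ∀ (x : 𝕋) (v : 𝔼), L ⟨x, v⟩ = ℓ v) (h : H1 𝕋) :
    ∃ ρ : 𝔼, constVelocityMeasure ρ ∈ matherMeasures g L h := by
  have hLc : Continuous L := hL.contMDiff.continuous
  have hne := matherMeasures_nonempty hLc hL.exists_mul_le h
  obtain ⟨μ, hμ⟩ := id hne
  have hprob := hμ.1.1.prob
  have hvel := integrable_velocity g hμ.1.1.firstMoment
  set ρ := ∫ p, velocity p ∂μ with hρ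
  have hfun : (fun v : 𝔼 ↦ L ⟨0, v⟩) = ℓ := funext fun v ↦ hLℓ 0 v
  have hℓ : ContDiff ℝ 2 ℓ := by
    rw [← hfun]
    exact contDiff_fiber hL.contMDiff 0
  have hpos : ∀ v w : 𝔼, w ≠ 0 → 0 < iteratedFDeriv ℝ 2 ℓ v ![w, w] := by
    intro v w hw
    have := hL.convex 0 v w hw
    rwa [hfun] at this
  have hadm : constVelocityMeasure ρ ∈ admissible g L h :=
    ⟨isClosedMeasure_constVelocityMeasure g ρ, hμ.1.2.1.constVelocityMeasure hμ.1.1,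
      integrable_constVelocityMeasure ρ hLc⟩
  -- Jensen's inequality: integrate the tangent hyperplane inequality at the mean `ρ`, where the
  -- linear term averages to zero.
  have hJ : ℓ ρ ≤ ∫ p, L p ∂μ := by
    have h0 : Integrable (fun p ↦ velocity p - ρ) μ := hvel.sub (integrable_const ρ)
    have h1 : Integrable (fun p ↦ fderiv ℝ ℓ ρ (velocity p - ρ)) μ :=
      (fderiv ℝ ℓ ρ).integrable_comp h0
    have h2 : ∫ p, (ℓ ρ + fderiv ℝ ℓ ρ (velocity p - ρ)) ∂μ ≤ ∫ p, L p ∂μ := by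
      refine integral_mono ((integrable_const _).add h1) hμ.1.2.2 fun p ↦ ?_
      have h3 : L p = ℓ (velocity p) := hLℓ p.1 p.2
      rw [h3]
      exact add_fderiv_le_of_iteratedFDeriv_pos hℓ hpos ρ (velocity p)
    have h3 : ∫ p, fderiv ℝ ℓ ρ (velocity p - ρ) ∂μ = 0 := by
      rw [(fderiv ℝ ℓ ρ).integral_comp_comm h0, integral_sub hvel (integrable_const ρ)]
      simp [hρ]
    rw [integral_add (integrable_const _) h1, h3] at h2
    simpa using h2
  have hint : ∫ p, L p ∂(constVelocityMeasure ρ) = ℓ ρ := by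
    rw [integral_constVelocityMeasure ρ hLc]
    have : ∀ x : 𝕋, L (constSection ρ x) = ℓ ρ := fun x ↦ hLℓ x ρ
    simp [this]
  refine ⟨ρ, mem_matherMeasures_of_eq_beta hne hadm (le_antisymm ?_ ?_)⟩
  · rw [hint, beta_eq_of_mem hμ]
    exact hJ
  · rw [beta_eq_of_mem hμ]
    exact hμ.2.2 ⟨_, hadm, rfl⟩

end FlatTorusMather

end Mane

end

theorem mainTheorem4 :
    (∀ {E : Type u} [NormedAddCommGroup E] [NormedSpace ℝ E] [FiniteDimensional ℝ E]
      {M : Type v} [TopologicalSpace M] [T2Space M] [CompactSpace M] [ChartedSpace E M]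
      [IsManifold 𝓘(ℝ, E) ∞ M]
      (g : Mane.Metric E M) (L : TangentBundle 𝓘(ℝ, E) M → ℝ), Mane.IsTonelli g L →
      ∀ V : M → ℝ, ContMDiff 𝓘(ℝ, E) 𝓘(ℝ, ℝ) 2 V → IsGreatest (Set.range V) 0 →
        (∀ h : Mane.H1 M, (Mane.matherMeasures g L h).Nonempty ∧
          (Mane.matherMeasures g (Mane.perturb L V) h).Nonempty) ∧
        (∀ h : Mane.H1 M, Mane.beta g (Mane.perturb L V) h ≤ Mane.beta g L h) ∧
        (∀ h : Mane.H1 M, h ≠ 0 →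
          (Mane.beta g (Mane.perturb L V) h = Mane.beta g L h ↔
            Mane.matherMeasures g L h ⊆ Mane.matherMeasures g (Mane.perturb L V) h ∧
            (∀ p ∈ Mane.matherSet g L h, V p.1 = 0) ∧
            Mane.matherSet g L h ⊆ Mane.matherSet g (Mane.perturb L V) h))) ∧
    (∀ (n : ℕ) (g : Mane.Metric (EuclideanSpace ℝ (Fin n)) (UnitAddTorus (Fin n)))
      (L : TangentBundle 𝓘(ℝ, EuclideanSpace ℝ (Fin n)) (UnitAddTorus (Fin n)) → ℝ),
      Mane.IsTonelli g L →
      ∀ ℓ : EuclideanSpace ℝ (Fin n) → ℝ,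
      (∀ a v : EuclideanSpace ℝ (Fin n),
        L (tangentMap 𝓘(ℝ, EuclideanSpace ℝ (Fin n)) 𝓘(ℝ, EuclideanSpace ℝ (Fin n))
          (Mane.torusProj n) ⟨a, v⟩) = ℓ v) →
      ∀ V : UnitAddTorus (Fin n) → ℝ,
        ContMDiff 𝓘(ℝ, EuclideanSpace ℝ (Fin n)) 𝓘(ℝ, ℝ) 2 V → IsGreatest (Set.range V) 0 →
        ∀ h : Mane.H1 (UnitAddTorus (Fin n)), h ≠ 0 →
          (Mane.beta g (Mane.perturb L V) h = Mane.beta g L h ↔ ∀ x, V x = 0)) := by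
  refine ⟨?_, ?_⟩
  · intro E _ _ _ M _ _ _ _ _ g L hL V hV hmax
    -- The maximum of `V` is attained, so `M` is nonempty and there are probability measures to
    -- minimize over.
    obtain ⟨x, -⟩ := hmax.1
    have : Nonempty M := ⟨x⟩
    have hVc : Continuous V := hV.continuous
    have hV0 : ∀ x, V x ≤ 0 := fun x ↦ hmax.2 ⟨x, rfl⟩
    have hLc : Continuous L := hL.contMDiff.continuous
    have h1 := fun h ↦ Mane.matherMeasures_nonempty hLc hL.exists_mul_le h
    have h2 := fun h ↦ Mane.matherMeasures_nonempty (L := Mane.perturb L V)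
      (hLc.add (Mane.continuous_comp_proj hVc)) (Mane.exists_mul_le_perturb hL.exists_mul_le hVc) h
    exact ⟨fun h ↦ ⟨h1 h, h2 h⟩, fun h ↦ Mane.beta_perturb_le hVc hV0 (h1 h) (h2 h),
      fun h _ ↦ Mane.beta_perturb_eq_iff hVc hV0 (h1 h) (h2 h)⟩
  · intro n g L hL ℓ hLℓ V hV hmax h _
    have hVc : Continuous V := hV.continuous
    have hV0 : ∀ x, V x ≤ 0 := fun x ↦ hmax.2 ⟨x, rfl⟩
    have hLc : Continuous L := hL.contMDiff.continuous
    refine ⟨fun hβ x ↦ ?_, fun hzero ↦ ?_⟩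
    · have hLℓ' : ∀ (x : UnitAddTorus (Fin n)) (v : EuclideanSpace ℝ (Fin n)),
          L ⟨x, v⟩ = ℓ v := by
        intro x v
        obtain ⟨a, rfl⟩ := Mane.torusProj_surjective n x
        rw [← hLℓ a v, Mane.tangentMap_torusProj]
      obtain ⟨ρ, hρ⟩ := Mane.exists_constVelocityMeasure_mem_matherMeasures hL hLℓ' h
      have h2 := Mane.matherMeasures_nonempty (L := Mane.perturb L V)
        (hLc.add (Mane.continuous_comp_proj hVc))
        (Mane.exists_mul_le_perturb hL.exists_mul_le hVc) h
      -- The uniform Mather measure has the point `(x, ρ)` in its support, for the given `x`.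
      exact (Mane.mem_matherMeasures_perturb hVc hV0 h2 hβ hρ).2 _
        (Mane.support_constVelocityMeasure ρ x)
    · have : Mane.perturb L V = L := funext fun p ↦ by
        change L p + V p.1 = L p
        rw [hzero, add_zero]
      rw [this]
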